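/- A digital image is a set $X$ with a symmetric antireflexive adjacency relation; a map of digital images is continuous if it sends adjacent points to adjacent or equal points. For $m\ge 1$ let $C_m$ be the digital cycle, the image with $m$ points $x_1,\dots,x_m$ in which two distinct points $x_i,x_j$ are adjacent exactly when $j\equiv i\pm1 \pmod m$. On $\mathbb{Z}^n$, $c_1$-adjacency means that two points differ by exactly $1$ in one coordinate and agree in all others. Three homology theories, all with integer coefficients, are used. - Simplicial homology $H_q(X)$: the chain group is generated by the ordered lists $\langle x_0,\dots,x_q\rangle$ of $q+1$ mutually adjacent points, with $\langle x_0,\dots,x_q\rangle=(-1)^\rho\langle x_{\rho(0)},\dots,x_{\rho(q)}\rangle$ for each permutation $\rho$, where $(-1)^\rho$ is its sign, and $\partial\langle x_0,\dots,x_q\rangle=\sum_{i=0}^q(-1)^i\langle x_0,\dots,\widehat{x_i},\dots,x_q\rangle$ for $q\ge1$. - Cubical homology $\bar H_q(X)$: the chain group is the free abelian group on the continuous maps $\sigma:\{0,1\}^q\to X$ (with $c_1$-adjacency on $\{0,1\}^q\subset\mathbb{Z}^q$), modulo the subgroup generated by those $\sigma$ that do not depend on one of their coordinates, and $\partial\sigma=\sum_{i=1}^q(-1)^i(A_i\sigma-B_i\sigma)$,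 where $A_i\sigma$ and $B_i\sigma$ are the faces of $\sigma$ with $i$-th coordinate $0$ and $1$. - $c_1$-cubical homology $\bar H^{c_1}_q(X)$ of a subset $X\subset\mathbb{Z}^n$ with $c_1$-adjacency: the chain group is the free abelian group on the elementary $q$-cubes $Q=J_1\times\dots\times J_n\subset X$, where each $J_i$ is $\{a\}$ or $\{a,a+1\}$ and exactly $q$ of the factors, $J_{j_1},\dots,J_{j_q}$ with $j_1<\dots<j_q$, have two points; $\partial Q=\sum_{i=1}^q(-1)^i(A_{j_i}Q-B_{j_i}Q)$, where $A_jQ$ and $B_jQ$ are obtained from $Q$ by replacing $J_j$ by $\{\min J_j\}$ and $\{\max J_j\}$. For even $m$, $\bar H^{c_1}_q(C_m)$ denotes $\bar H^{c_1}_q(X)$ for any subset $X$ of any $\mathbb{Z}^n$ which, with $c_1$-adjacency, is isomorphic to $C_m$; the assertions below hold for every such $X$. **Theorem.** For $1\le m<4$, $$H_q(C_m)\cong\bar H_q(C_m)\cong\bar H_q^{c_1}(C_2)\cong\begin{cases}\mathbb{Z}&\text{if }q=0,\\0&\text{if }q>0.\end{cases}$$ For $m=4$, $$H_q(C_4)\cong\begin{cases}\mathbb{Z}&\text{if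 }q\in\{0,1\},\\0&\text{if }q>1,\end{cases}\qquad \bar H_q(C_4)\cong\bar H_q^{c_1}(C_4)\cong\begin{cases}\mathbb{Z}&\text{if }q=0,\\0&\text{if }q>0.\end{cases}$$ For every $m>4$, $$H_q(C_m)\cong\begin{cases}\mathbb{Z}&\text{if }q\in\{0,1\},\\0&\text{if }q>1,\end{cases}\qquad \bar H_0(C_m)\cong\mathbb{Z},\quad \bar H_1(C_m)\cong\mathbb{Z}.$$ For every even $m>4$ and every $q\ge0$, $H_q(C_m)\cong\bar H_q^{c_1}(C_m)$. -/

import Mathlib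

open CategoryTheory

namespace DigitalHomology

universe u

/-! ### Digital images

A digital image is a set with a symmetric antireflexive adjacency relation, i.e. a `SimpleGraph`.
The digital cycle on `m` points is Mathlib's `SimpleGraph.cycleGraph m`. -/

/-- The adjacency `c_k` on `ℤⁿ`: two distinct points are adjacent when their coordinates differ by
at most `1` in at most `k` positions and agree in all other positions. -/
def latticeGraph (n k : ℕ) : SimpleGraph (Fin n → ℤ) where
  Adj x y := x ≠ y ∧ (∀ i, |x i - y i| ≤ 1) ∧ (Finset.univ.filter fun i => x i ≠ y i).card ≤ k
  symm := ⟨by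
    rintro x y ⟨h1, h2, h3⟩
    refine ⟨h1.symm, fun i => by rw [abs_sub_comm]; exact h2 i, ?_⟩
    simpa only [ne_comm] using h3⟩
  loopless := ⟨fun _ h => h.1 rfl⟩

/-- Digital continuity: adjacent points are sent to adjacent or equal points. -/
def IsDigitallyContinuous {V W : Type*} (G : SimpleGraph V) (H : SimpleGraph W) (f : V → W) :
    Prop :=
  ∀ ⦃x y : V⦄, G.Adj x y → f x = f y ∨ H.Adj (f x) (f y)

/-! ### A sign cancellation common to the three boundary operators -/

lemma alternating_sum_cancel {M : Type*} [AddCommGroup M] {n : ℕ}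
    (F : Fin (n + 2) → Fin (n + 1) → M)
    (h : ∀ i j : Fin (n + 1), i ≤ j → F i.castSucc j = F j.succ i) :
    ∑ i : Fin (n + 2), ∑ j : Fin (n + 1), ((-1 : ℤ) ^ (i : ℕ) * (-1) ^ (j : ℕ)) • F i j = 0 := by
  rw [← Finset.sum_product' (f := fun (i : Fin (n + 2)) (j : Fin (n + 1)) =>
    ((-1 : ℤ) ^ (i : ℕ) * (-1) ^ (j : ℕ)) • F i j)]
  rw [← Finset.sum_filter_add_sum_filter_not _ (fun p => p.1 ≤ p.2.castSucc)]
  rw [← eq_neg_iff_add_eq_zero, ← Finset.sum_neg_distrib]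
  refine Finset.sum_bij (fun p hp => (p.2.succ, p.1.castLT ?_)) ?_ ?_ ?_ ?_
  · have := (Finset.mem_filter.1 hp).2
    exact lt_of_le_of_lt (Fin.le_def.1 this) p.2.2
  · rintro ⟨i, j⟩ hp
    have := (Finset.mem_filter.1 hp).2
    simp only [Fin.le_def, Fin.val_castSucc] at this
    simp only [Finset.univ_product_univ, Finset.mem_filter, Finset.mem_univ, true_and, Fin.le_def,
      Fin.val_succ, Fin.val_castSucc, Fin.val_castLT]
    omega
  · rintro ⟨i, j⟩ hp ⟨i', j'⟩ hp' he
    simp only [Prod.mk.injEq, Fin.ext_iff, Fin.val_succ, Fin.val_castLT] at he ⊢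
    omega
  · rintro ⟨i, j⟩ hp
    have := (Finset.mem_filter.1 hp).2
    simp only [Fin.le_def, Fin.val_castSucc, not_le] at this
    refine ⟨(j.castSucc, i.pred (by rintro rfl; simp at this)), ?_, ?_⟩
    · simp only [Finset.univ_product_univ, Finset.mem_filter, Finset.mem_univ, true_and,
        Fin.le_def, Fin.val_castSucc, Fin.val_pred]
      omega
    · simp
  · rintro ⟨i, j⟩ hp
    have := (Finset.mem_filter.1 hp).2
    simp only [Fin.le_def, Fin.val_castSucc] at this
    have hi : (i : ℕ) < n + 1 := lt_of_le_of_lt this j.2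
    have e := h (i.castLT hi) j (by simpa [Fin.le_def] using this)
    rw [Fin.castSucc_castLT] at e
    simp only [Fin.val_succ, Fin.val_castLT]
    rw [e, ← neg_smul]
    congr 1
    ring

lemma succAbove_comm {n : ℕ} (i j : Fin (n + 1)) (h : i ≤ j) (k : Fin n) :
    i.castSucc.succAbove (j.succAbove k) = j.succ.succAbove (i.succAbove k) := by
  rw [Fin.le_def] at h
  ext
  simp only [Fin.succAbove, Fin.lt_def, Fin.val_castSucc, Fin.val_succ]
  split_ifs <;> simp_all <;> omega

/-! ### Simplicial homology -/

section Simplicial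

variable {V : Type u} (G : SimpleGraph V)

/-- Ordered `q`-simplices: lists of `q + 1` mutually adjacent points. -/
def OrderedSimplex (q : ℕ) : Type u :=
  {x : Fin (q + 1) → V // ∀ i j, i ≠ j → G.Adj (x i) (x j)}

variable {G}

/-- Omission of the point of index `i`. -/
def OrderedSimplex.face {q : ℕ} (x : OrderedSimplex G (q + 1)) (i : Fin (q + 2)) :
    OrderedSimplex G q :=
  ⟨fun k => x.1 (i.succAbove k), fun a b h =>
    x.2 _ _ (fun e => h (Fin.succAbove_right_injective e))⟩

/-- Reordering of the points by a permutation. -/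
def OrderedSimplex.permute {q : ℕ} (x : OrderedSimplex G q) (ρ : Equiv.Perm (Fin (q + 1))) :
    OrderedSimplex G q :=
  ⟨fun k => x.1 (ρ k), fun _ _ h => x.2 _ _ (fun e => h (ρ.injective e))⟩

variable (G)

/-- The relations `⟨x₀, …, x_q⟩ = (-1)^ρ ⟨x_{ρ 0}, …, x_{ρ q}⟩`. -/
noncomputable def simplicialRelations (q : ℕ) : Submodule ℤ (OrderedSimplex G q →₀ ℤ) :=
  Submodule.span ℤ {c | ∃ (x : OrderedSimplex G q) (ρ : Equiv.Perm (Fin (q + 1))),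
    c = Finsupp.single x 1 - (Equiv.Perm.sign ρ : ℤ) • Finsupp.single (x.permute ρ) 1}

/-- The simplicial chain group `C_q`. -/
abbrev SimplicialChain (q : ℕ) : Type u :=
  (OrderedSimplex G q →₀ ℤ) ⧸ simplicialRelations G q

variable {G}

/-- The class `⟨x₀, …, x_q⟩` of an ordered simplex in the chain group. -/
noncomputable def OrderedSimplex.toChain {q : ℕ} (x : OrderedSimplex G q) : SimplicialChain G q :=
  Submodule.Quotient.mk (Finsupp.single x 1)

lemma OrderedSimplex.toChain_permute {q : ℕ} (x : OrderedSimplex G q)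
    (ρ : Equiv.Perm (Fin (q + 1))) :
    x.toChain = (Equiv.Perm.sign ρ : ℤ) • (x.permute ρ).toChain := by
  rw [OrderedSimplex.toChain, OrderedSimplex.toChain, ← Submodule.Quotient.mk_smul,
    Submodule.Quotient.eq]
  exact Submodule.subset_span ⟨x, ρ, rfl⟩

lemma exists_perm_succAbove {n : ℕ} (ρ : Equiv.Perm (Fin (n + 1))) (i : Fin (n + 1)) :
    ∃ τ : Equiv.Perm (Fin n), (∀ k, ρ (i.succAbove k) = (ρ i).succAbove (τ k)) ∧
      (Equiv.Perm.sign τ : ℤ) =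
        (-1) ^ (i : ℕ) * (-1) ^ ((ρ i : Fin (n + 1)) : ℕ) * (Equiv.Perm.sign ρ : ℤ) := by
  obtain ⟨⟨p, τ⟩, hπ⟩ := Equiv.Perm.decomposeFin.symm.surjective
    ((ρ i).cycleRange * ρ * i.cycleRange⁻¹)
  have hinv : ∀ (i a b : Fin (n + 1)), i.cycleRange a = b → i.cycleRange⁻¹ b = a := by
    intro i a b e
    rw [← e]
    exact Equiv.symm_apply_apply _ _
  have h0 : ((ρ i).cycleRange * ρ * i.cycleRange⁻¹) 0 = 0 := by
    simp only [Equiv.Perm.mul_apply]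
    rw [hinv i _ 0 (Fin.cycleRange_self i), Fin.cycleRange_self]
  have hp : p = 0 := by
    rw [← hπ, Equiv.Perm.decomposeFin_symm_apply_zero] at h0
    exact h0
  subst hp
  refine ⟨τ, fun k => ?_, ?_⟩
  · have h1 : ((ρ i).cycleRange * ρ * i.cycleRange⁻¹) k.succ = (τ k).succ := by
      rw [← hπ, Equiv.Perm.decomposeFin_symm_apply_succ]
      simp
    simp only [Equiv.Perm.mul_apply] at h1
    rw [hinv i _ _ (Fin.cycleRange_succAbove i k), ← Fin.cycleRange_succAbove (ρ i) (τ k)] at h1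
    exact (ρ i).cycleRange.injective h1
  · have hs := congrArg Equiv.Perm.sign hπ
    rw [Equiv.Perm.decomposeFin.symm_sign, if_pos rfl, one_mul] at hs
    rw [hs]
    simp only [map_mul, map_inv, Fin.sign_cycleRange]
    rw [Int.units_inv_eq_self]
    push_cast
    ring

/-- The value `∑ (-1)^i ⟨x₀, …, x̂ᵢ, …, x_q⟩` of the boundary on an ordered simplex. -/
noncomputable def OrderedSimplex.boundary {q : ℕ} (x : OrderedSimplex G (q + 1)) : SimplicialChain G q :=
  ∑ i : Fin (q + 2), (-1 : ℤ) ^ (i : ℕ) • (x.face i).toChain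

lemma OrderedSimplex.boundary_permute {q : ℕ} (x : OrderedSimplex G (q + 1))
    (ρ : Equiv.Perm (Fin (q + 2))) :
    x.boundary = (Equiv.Perm.sign ρ : ℤ) • (x.permute ρ).boundary := by
  rw [OrderedSimplex.boundary, OrderedSimplex.boundary, ← Equiv.sum_comp ρ, Finset.smul_sum]
  refine Finset.sum_congr rfl fun i _ => ?_
  obtain ⟨τ, h1, h2⟩ := exists_perm_succAbove ρ i
  have e : (x.face (ρ i)).permute τ = (x.permute ρ).face i :=
    Subtype.ext (funext fun k => congrArg x.1 (h1 k).symm)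
  rw [(x.face (ρ i)).toChain_permute τ, e, h2, smul_smul, smul_smul]
  congr 1
  have : ((-1 : ℤ) ^ ((ρ i : Fin (q + 2)) : ℕ)) * (-1) ^ ((ρ i : Fin (q + 2)) : ℕ) = 1 := by
    rw [← mul_pow]; simp
  linear_combination ((-1 : ℤ) ^ (i : ℕ) * (Equiv.Perm.sign ρ : ℤ)) * this

variable (G)

/-- The simplicial boundary operator `∂ : C_{q+1} → C_q`. -/
noncomputable def simplicialBoundary (q : ℕ) : SimplicialChain G (q + 1) →ₗ[ℤ] SimplicialChain G q :=
  (simplicialRelations G (q + 1)).liftQ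
    (Finsupp.linearCombination ℤ fun x : OrderedSimplex G (q + 1) => x.boundary) <| by
      rw [simplicialRelations, Submodule.span_le]
      rintro _ ⟨x, ρ, rfl⟩
      simp only [SetLike.mem_coe, LinearMap.mem_ker, map_sub, map_smul,
        Finsupp.linearCombination_single, one_smul]
      exact sub_eq_zero.2 (x.boundary_permute ρ)

variable {G}

lemma simplicialBoundary_toChain {q : ℕ} (x : OrderedSimplex G (q + 1)) :
    simplicialBoundary G q x.toChain = x.boundary := by
  rw [simplicialBoundary, OrderedSimplex.toChain]
  erw [Submodule.liftQ_apply]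
  rw [Finsupp.linearCombination_single, one_smul]

variable (G)

lemma simplicialBoundary_comp (q : ℕ) :
    simplicialBoundary G q ∘ₗ simplicialBoundary G (q + 1) = 0 := by
  refine Submodule.linearMap_qext _ (Finsupp.lhom_ext' fun x => LinearMap.ext_ring ?_)
  change simplicialBoundary G q (simplicialBoundary G (q + 1) x.toChain) = 0
  rw [simplicialBoundary_toChain, OrderedSimplex.boundary, map_sum]
  simp only [map_smul, simplicialBoundary_toChain, OrderedSimplex.boundary, Finset.smul_sum,
    smul_smul]
  exact alternating_sum_cancel (fun i j => ((x.face i).face j).toChain) fun i j h =>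
    congrArg _ (Subtype.ext (funext fun k => congrArg x.1 (succAbove_comm i j h k)))

/-- The simplicial chain complex of a digital image. -/
noncomputable def simplicialComplex : ChainComplex (ModuleCat.{u} ℤ) ℕ :=
  ChainComplex.of (fun q => ModuleCat.of ℤ (SimplicialChain G q))
    (fun q => ModuleCat.ofHom (simplicialBoundary G q))
    (fun q => by rw [← ModuleCat.ofHom_comp, simplicialBoundary_comp]; rfl)

/-- Simplicial homology `H_q`. -/
noncomputable abbrev simplicialHomology (q : ℕ) : ModuleCat.{u} ℤ := (simplicialComplex G).homology q

end Simplicial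

/-! ### Cubical homology -/

section Cubical

/-- The image `I^q = {0, 1}^q ⊂ ℤ^q` with `c_1`-adjacency. -/
def unitCube (q : ℕ) : SimpleGraph (Fin q → Fin 2) :=
  (latticeGraph q 1).comap fun t i => ((t i : ℕ) : ℤ)

variable {V : Type u} (G : SimpleGraph V)

/-- The `q`-cubes of a digital image: continuous maps `I^q → X`. -/
def Cube (q : ℕ) : Type u :=
  {σ : (Fin q → Fin 2) → V // IsDigitallyContinuous (unitCube q) G σ}

variable {G}

/-- A cube is degenerate if it does not depend on one of its coordinates. -/
def Cube.IsDegenerate {q : ℕ} (σ : Cube G q) : Prop :=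
  ∃ i : Fin q, ∀ (t : Fin q → Fin 2) (a : Fin 2), σ.1 (Function.update t i a) = σ.1 t

lemma unitCube_adj_insertNth {q : ℕ} (i : Fin (q + 1)) (ε : Fin 2) {s t : Fin q → Fin 2}
    (h : (unitCube q).Adj s t) :
    (unitCube (q + 1)).Adj (i.insertNth ε s : Fin (q + 1) → Fin 2) (i.insertNth ε t) := by
  obtain ⟨h1, h2, h3⟩ := h
  refine ⟨fun e => h1 (funext fun k => ?_), fun k => ?_, ?_⟩
  · simpa using congrFun e (i.succAbove k)
  · refine Fin.succAboveCases i ?_ (fun k => ?_) k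
    · simp
    · simpa using h2 k
  · refine le_trans (le_of_eq ?_) h3
    rw [Finset.card_filter, Finset.card_filter, Fin.sum_univ_succAbove _ i]
    simp

/-- The faces `A_i σ` (for `ε = 0`) and `B_i σ` (for `ε = 1`). -/
def Cube.face {q : ℕ} (ε : Fin 2) (i : Fin (q + 1)) (σ : Cube G (q + 1)) : Cube G q :=
  ⟨fun t => σ.1 (i.insertNth ε t), fun _ _ h => σ.2 (unitCube_adj_insertNth i ε h)⟩

lemma insertNth_comm {q : ℕ} (ε η : Fin 2) (i j : Fin (q + 1)) (h : i ≤ j) (t : Fin q → Fin 2) :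
    (i.castSucc.insertNth ε (j.insertNth η t : Fin (q + 1) → Fin 2) : Fin (q + 2) → Fin 2) =
      j.succ.insertNth η (i.insertNth ε t : Fin (q + 1) → Fin 2) := by
  have h1 : j.succ.succAbove i = i.castSucc := Fin.succAbove_succ_of_le _ _ h
  have h2 : i.castSucc.succAbove j = j.succ := Fin.succAbove_castSucc_of_le _ _ h
  funext k
  refine Fin.succAboveCases i.castSucc ?_ (fun l => ?_) k
  · rw [Fin.insertNth_apply_same]
    conv_rhs => rw [← h1]
    rw [Fin.insertNth_apply_succAbove, Fin.insertNth_apply_same]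
  · rw [Fin.insertNth_apply_succAbove]
    refine Fin.succAboveCases j ?_ (fun r => ?_) l
    · rw [Fin.insertNth_apply_same, h2, Fin.insertNth_apply_same]
    · rw [Fin.insertNth_apply_succAbove, succAbove_comm i j h, Fin.insertNth_apply_succAbove,
        Fin.insertNth_apply_succAbove]

lemma Cube.face_comm {q : ℕ} (ε η : Fin 2) (i j : Fin (q + 1)) (h : i ≤ j) (σ : Cube G (q + 2)) :
    (σ.face ε i.castSucc).face η j = (σ.face η j.succ).face ε i :=
  Subtype.ext (funext fun t =>
    congrArg σ.1 (insertNth_comm ε η i j h t))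

variable (G)

/-- The subgroup `D_q` generated by the degenerate cubes. -/
noncomputable def degenerateChains (q : ℕ) : Submodule ℤ (Cube G q →₀ ℤ) :=
  Submodule.span ℤ {c | ∃ σ : Cube G q, σ.IsDegenerate ∧ c = Finsupp.single σ 1}

/-- The group of cubical chains `Q_q / D_q`. -/
abbrev CubicalChain (q : ℕ) : Type u := (Cube G q →₀ ℤ) ⧸ degenerateChains G q

variable {G}

/-- The class of a cube in the group of cubical chains. -/
noncomputable def Cube.toChain {q : ℕ} (σ : Cube G q) : CubicalChain G q :=
  Submodule.Quotient.mk (Finsupp.single σ 1)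

lemma Cube.toChain_eq_zero {q : ℕ} {σ : Cube G q} (h : σ.IsDegenerate) : σ.toChain = 0 :=
  (Submodule.Quotient.mk_eq_zero _).2 (Submodule.subset_span ⟨σ, h, rfl⟩)

/-- The value `∑ (-1)^i (A_i σ - B_i σ)` of the boundary on a cube. The coordinates are numbered
from `0` here and from `1` in the formula, whence the exponent. -/
noncomputable def Cube.boundary {q : ℕ} (σ : Cube G (q + 1)) : CubicalChain G q :=
  ∑ i : Fin (q + 1), (-1 : ℤ) ^ ((i : ℕ) + 1) • ((σ.face 0 i).toChain - (σ.face 1 i).toChain)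

lemma Cube.boundary_eq_zero {q : ℕ} {σ : Cube G (q + 1)} (h : σ.IsDegenerate) :
    σ.boundary = 0 := by
  obtain ⟨i, hi⟩ := h
  refine Finset.sum_eq_zero fun j _ => ?_
  rcases eq_or_ne j i with rfl | hj
  · have : σ.face 0 j = σ.face 1 j := by
      refine Subtype.ext (funext fun t => ?_)
      have e := hi (j.insertNth 1 t) 0
      rw [Fin.update_insertNth] at e
      exact e
    rw [this, sub_self, smul_zero]
  · obtain ⟨k, rfl⟩ := Fin.exists_succAbove_eq hj.symm
    have key : ∀ ε, (σ.face ε j).IsDegenerate := fun ε => ⟨k, fun t a => by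
      change σ.1 (j.insertNth ε (Function.update t k a)) = σ.1 (j.insertNth ε t)
      rw [Fin.insertNth_update]
      exact hi _ _⟩
    rw [Cube.toChain_eq_zero (key 0), Cube.toChain_eq_zero (key 1), sub_self, smul_zero]

variable (G)

/-- The cubical boundary operator. -/
noncomputable def cubicalBoundary (q : ℕ) : CubicalChain G (q + 1) →ₗ[ℤ] CubicalChain G q :=
  (degenerateChains G (q + 1)).liftQ
    (Finsupp.linearCombination ℤ fun σ : Cube G (q + 1) => σ.boundary) <| by
      rw [degenerateChains, Submodule.span_le]
      rintro _ ⟨σ, h, rfl⟩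
      simp only [SetLike.mem_coe, LinearMap.mem_ker, Finsupp.linearCombination_single, one_smul]
      exact Cube.boundary_eq_zero h

variable {G}

lemma cubicalBoundary_toChain {q : ℕ} (σ : Cube G (q + 1)) :
    cubicalBoundary G q σ.toChain = σ.boundary := by
  rw [cubicalBoundary, Cube.toChain]
  erw [Submodule.liftQ_apply]
  rw [Finsupp.linearCombination_single, one_smul]

variable (G)

lemma cubicalBoundary_comp (q : ℕ) :
    cubicalBoundary G q ∘ₗ cubicalBoundary G (q + 1) = 0 := by
  refine Submodule.linearMap_qext _ (Finsupp.lhom_ext' fun σ => LinearMap.ext_ring ?_)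
  change cubicalBoundary G q (cubicalBoundary G (q + 1) σ.toChain) = 0
  rw [cubicalBoundary_toChain, Cube.boundary, map_sum]
  simp only [map_smul, map_sub, cubicalBoundary_toChain, Cube.boundary,
    ← Finset.sum_sub_distrib, ← smul_sub, Finset.smul_sum, smul_smul]
  rw [← alternating_sum_cancel (fun i j => (((σ.face 0 i).face 0 j).toChain -
      ((σ.face 0 i).face 1 j).toChain) - (((σ.face 1 i).face 0 j).toChain -
      ((σ.face 1 i).face 1 j).toChain)) fun i j h => by
    simp only [Cube.face_comm _ _ i j h]; abel]
  refine Finset.sum_congr rfl fun i _ => Finset.sum_congr rfl fun j _ => ?_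
  congr 1
  ring

/-- The cubical chain complex of a digital image. -/
noncomputable def cubicalComplex : ChainComplex (ModuleCat.{u} ℤ) ℕ :=
  ChainComplex.of (fun q => ModuleCat.of ℤ (CubicalChain G q))
    (fun q => ModuleCat.ofHom (cubicalBoundary G q))
    (fun q => by rw [← ModuleCat.ofHom_comp, cubicalBoundary_comp]; rfl)

/-- Cubical homology `H̄_q`. -/
noncomputable abbrev cubicalHomology (q : ℕ) : ModuleCat.{u} ℤ := (cubicalComplex G).homology q

end Cubical

/-! ### `c_1`-cubical homology of subsets of `ℤⁿ` -/

section C1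

/-- An elementary `q`-cube `J_1 × ⋯ × J_n` in `ℤⁿ`, given by the point `(min J_1, …, min J_n)` and
by the increasing sequence `j_1 < ⋯ < j_q` of the indices of its nondegenerate factors. -/
@[ext] structure ElementaryCube (n q : ℕ) where
  corner : Fin n → ℤ
  dirs : Fin q ↪o Fin n

open Classical in
/-- The factor `J_i`: `{a, a + 1}` in a nondegenerate direction and `{a}` in the others. -/
noncomputable def ElementaryCube.interval {n q : ℕ} (Q : ElementaryCube n q) (i : Fin n) : Set ℤ :=
  if i ∈ Set.range Q.dirs then {Q.corner i, Q.corner i + 1} else {Q.corner i}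

/-- The subset `J_1 × ⋯ × J_n` of `ℤⁿ`. -/
def ElementaryCube.toSet {n q : ℕ} (Q : ElementaryCube n q) : Set (Fin n → ℤ) :=
  Set.pi Set.univ Q.interval

/-- The faces `A_{j_i} Q` (for `ε = 0`) and `B_{j_i} Q` (for `ε = 1`), in which the factor
`J_{j_i}` is replaced by its minimum, respectively its maximum. -/
def ElementaryCube.face {n q : ℕ} (ε : Fin 2) (i : Fin (q + 1)) (Q : ElementaryCube n (q + 1)) :
    ElementaryCube n q where
  corner := Function.update Q.corner (Q.dirs i) (Q.corner (Q.dirs i) + ((ε : ℕ) : ℤ))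
  dirs := (Fin.succAboveOrderEmb i).trans Q.dirs

lemma ElementaryCube.toSet_face_subset {n q : ℕ} (ε : Fin 2) (i : Fin (q + 1))
    (Q : ElementaryCube n (q + 1)) : (Q.face ε i).toSet ⊆ Q.toSet := by
  intro x hx k _
  have hk := hx k (Set.mem_univ k)
  simp only [ElementaryCube.interval] at hk ⊢
  by_cases hki : k = Q.dirs i
  · subst hki
    have hnot : Q.dirs i ∉ Set.range (Q.face ε i).dirs := by
      rintro ⟨a, ha⟩
      exact Fin.succAbove_ne i a (Q.dirs.injective ha)
    rw [if_neg hnot] at hk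
    rw [if_pos (Set.mem_range_self i)]
    simp only [ElementaryCube.face, Function.update_self, Set.mem_singleton_iff] at hk
    fin_cases ε <;> simp_all
  · have hc : (Q.face ε i).corner k = Q.corner k := by
      simp [ElementaryCube.face, Function.update_of_ne hki]
    have hr : k ∈ Set.range (Q.face ε i).dirs ↔ k ∈ Set.range Q.dirs := by
      constructor
      · rintro ⟨a, rfl⟩
        exact ⟨_, rfl⟩
      · rintro ⟨a, rfl⟩
        have ha : a ≠ i := fun e => hki (by rw [e])
        obtain ⟨b, rfl⟩ := Fin.exists_succAbove_eq ha
        exact ⟨b, rfl⟩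
    simpa only [hc, hr] using hk

lemma ElementaryCube.face_comm {n q : ℕ} (ε η : Fin 2) (i j : Fin (q + 1)) (h : i ≤ j)
    (Q : ElementaryCube n (q + 2)) :
    (Q.face ε i.castSucc).face η j = (Q.face η j.succ).face ε i := by
  have h1 : i.castSucc.succAbove j = j.succ := Fin.succAbove_castSucc_of_le _ _ h
  have h2 : j.succ.succAbove i = i.castSucc := Fin.succAbove_succ_of_le _ _ h
  have hne : Q.dirs j.succ ≠ Q.dirs i.castSucc := fun e => by
    have := congrArg Fin.val (Q.dirs.injective e)
    rw [Fin.le_def] at h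
    simp at this
    omega
  have hdirs : ((Q.face ε i.castSucc).face η j).dirs = ((Q.face η j.succ).face ε i).dirs := by
    refine RelEmbedding.ext fun k => ?_
    exact congrArg Q.dirs (succAbove_comm i j h k)
  refine ElementaryCube.ext ?_ hdirs
  change Function.update (Function.update Q.corner _ _) (Q.dirs (i.castSucc.succAbove j)) _ =
    Function.update (Function.update Q.corner _ _) (Q.dirs (j.succ.succAbove i)) _
  simp only [ElementaryCube.face, RelEmbedding.coe_trans, Function.comp_apply,
    Fin.succAboveOrderEmb_apply, h1, h2]
  rw [Function.update_of_ne hne, Function.update_of_ne hne.symm, Function.update_comm hne.symm]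

variable {n : ℕ} (X : Set (Fin n → ℤ))

/-- The elementary `q`-cubes contained in `X`. -/
def C1Cube (q : ℕ) : Type := {Q : ElementaryCube n q // Q.toSet ⊆ X}

/-- The group of `c_1`-cubical `q`-chains of `X`. -/
abbrev C1Chain (q : ℕ) : Type := C1Cube X q →₀ ℤ

variable {X}

/-- Faces of an elementary cube of `X`. -/
def C1Cube.face {q : ℕ} (ε : Fin 2) (i : Fin (q + 1)) (Q : C1Cube X (q + 1)) : C1Cube X q :=
  ⟨Q.1.face ε i, (Q.1.toSet_face_subset ε i).trans Q.2⟩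

/-- The value `∑ (-1)^i (A_{j_i} Q - B_{j_i} Q)` of the boundary on an elementary cube, with
indices numbered from `0`. -/
noncomputable def C1Cube.boundary {q : ℕ} (Q : C1Cube X (q + 1)) : C1Chain X q :=
  ∑ i : Fin (q + 1), (-1 : ℤ) ^ ((i : ℕ) + 1) •
    (Finsupp.single (Q.face 0 i) (1 : ℤ) - Finsupp.single (Q.face 1 i) 1)

variable (X)

/-- The `c_1`-cubical boundary operator. -/
noncomputable def c1Boundary (q : ℕ) : C1Chain X (q + 1) →ₗ[ℤ] C1Chain X q :=
  Finsupp.linearCombination ℤ fun Q : C1Cube X (q + 1) => Q.boundary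

lemma c1Boundary_comp (q : ℕ) : c1Boundary X q ∘ₗ c1Boundary X (q + 1) = 0 := by
  refine Finsupp.lhom_ext' fun Q => LinearMap.ext_ring ?_
  have hb : ∀ (r : ℕ) (P : C1Cube X (r + 1)),
      c1Boundary X r (Finsupp.single P 1) = P.boundary := fun r P => by
    rw [c1Boundary, Finsupp.linearCombination_single, one_smul]
  change c1Boundary X q (c1Boundary X (q + 1) (Finsupp.single Q 1)) = 0
  rw [hb, C1Cube.boundary, map_sum]
  simp only [map_smul, map_sub, hb, C1Cube.boundary,
    ← Finset.sum_sub_distrib, ← smul_sub, Finset.smul_sum, smul_smul]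
  rw [← alternating_sum_cancel (fun i j =>
      ((Finsupp.single ((Q.face 0 i).face 0 j) (1 : ℤ) -
        Finsupp.single ((Q.face 0 i).face 1 j) 1) -
      (Finsupp.single ((Q.face 1 i).face 0 j) 1 -
        Finsupp.single ((Q.face 1 i).face 1 j) 1) : C1Chain X q)) fun i j h => by
    have hc : ∀ ε η : Fin 2, (Q.face ε i.castSucc).face η j = (Q.face η j.succ).face ε i :=
      fun ε η => Subtype.ext (ElementaryCube.face_comm ε η i j h Q.1)
    simp only [hc]; abel]
  refine Finset.sum_congr rfl fun i _ => Finset.sum_congr rfl fun j _ => ?_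
  congr 1
  ring

/-- The `c_1`-cubical chain complex of `X ⊆ ℤⁿ`. -/
noncomputable def c1Complex : ChainComplex (ModuleCat.{0} ℤ) ℕ :=
  ChainComplex.of (fun q => ModuleCat.of ℤ (C1Chain X q))
    (fun q => ModuleCat.ofHom (c1Boundary X q))
    (fun q => by rw [← ModuleCat.ofHom_comp, c1Boundary_comp]; rfl)

/-- `c_1`-cubical homology of `X ⊆ ℤⁿ`. -/
noncomputable abbrev c1Homology (q : ℕ) : ModuleCat.{0} ℤ := (c1Complex X).homology q

/-- `X ⊆ ℤⁿ` with `c_1`-adjacency is a copy of the digital cycle on `m` points. -/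
def IsEmbeddedCycle (m : ℕ) : Prop :=
  Nonempty (SimpleGraph.cycleGraph m ≃g (latticeGraph n 1).induce X)

end C1

end DigitalHomology

/-!
The three theories are computed by elementary means, from explicit descriptions of the chains in
low degrees.

In degree `0` the homology of a connected image is infinite cyclic in each theory: the augmentation
detects it, and adjacent points are homologous (`nonempty_homology_zero_of_connected`).

In positive degrees the homology vanishes in these cases. In a cycle of at most three points, each
point is adjacent to all others, and the cone with apex such a point is a contracting homotopy of
the simplicial chains (`simplicialHomology_succ_of_cone`). A cycle of at most four points contracts
to a point in at most two steps, and the prism operator shows that homotopic maps agree on cubical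
homology (`cubicalHomology_succ_of_contractible`). An embedded cycle of two points has one edge,
with nonzero boundary, and no squares. An embedded cycle of four points is the vertex set of
exactly one elementary square (`exists_square`), the boundary of which is the whole cycle up to
sign, and it contains no larger cubes.

In the remaining cases the degree `1` homology is infinite cyclic, by one argument for all theories
(`nonempty_homology_one_of_winding`): up to boundaries the `1`-chains are combinations of the
consecutive edges of the cycle. If such a combination is a cycle, then its coefficients are all
equal, so that it is a multiple of the sum of the edges. The multiples are not homologous to each
other, as they are told apart by the winding number `∑ cycleStep`, the signed number of steps
around the cycle. It vanishes on boundaries since a closed walk of length four makes a number of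
steps that is divisible by the number of points and at most four in absolute value
(`cycleStep_sum_four`); for the simplicial and the `c_1`-cubical theories there are no `2`-chains
at all, because a cycle of at least four points has no triangles and a cycle of more than four
points has no four-cycles.
-/

namespace DigitalHomology

universe u

/-! ### Homology groups of an explicit chain complex -/

section Algebra

/-- The homology is free of rank one when every cycle is homologous to a unique multiple of `z₀`. It
is stated over any ring, so that a single module structure is in sight; over `ℤ` the structures on
kernels and quotients agree with the canonical ones only propositionally. -/
lemma nonempty_homology_addEquiv_ring {R : Type*} [CommRing R]
    (S : ShortComplex (ModuleCat.{u} R)) (z₀ : S.X₂)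
    (hz₀ : S.g z₀ = 0) (hgen : ∀ z, S.g z = 0 → ∃ k : R, ∃ y, S.f y = z - k • z₀)
    (hfree : ∀ (k : R) (y), S.f y = k • z₀ → k = 0) : Nonempty (S.homology ≃+ R) := by
  let Z : LinearMap.ker S.g.hom := ⟨z₀, hz₀⟩
  let φ : R →ₗ[R] (LinearMap.ker S.g.hom ⧸ LinearMap.range S.moduleCatToCycles) :=
    (LinearMap.range S.moduleCatToCycles).mkQ ∘ₗ LinearMap.toSpanSingleton R _ Z
  have hφ : Function.Bijective φ := by
    refine ⟨(injective_iff_map_eq_zero φ).2 fun k hk => ?_, fun w => ?_⟩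
    · obtain ⟨y, hy⟩ := (Submodule.Quotient.mk_eq_zero _).1 hk
      exact hfree k y (congrArg Subtype.val hy)
    · obtain ⟨⟨z, hz⟩, rfl⟩ := Submodule.Quotient.mk_surjective _ w
      obtain ⟨k, y, hy⟩ := hgen z hz
      have hmem : (⟨z, hz⟩ : LinearMap.ker S.g.hom) - k • Z ∈
          LinearMap.range S.moduleCatToCycles := ⟨y, Subtype.ext hy⟩
      exact ⟨k, ((Submodule.Quotient.eq _).2 hmem).symm⟩
  exact ⟨S.moduleCatHomologyIso.toLinearEquiv.toAddEquiv.trans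
    (LinearEquiv.ofBijective φ hφ).symm.toAddEquiv⟩

variable {C : ℕ → Type u} [∀ q, AddCommGroup (C q)] [∀ q, Module ℤ (C q)]
  (d : ∀ q, C (q + 1) →ₗ[ℤ] C q)
  (sq : ∀ q, ModuleCat.ofHom (d (q + 1)) ≫ ModuleCat.ofHom (d q) = 0)

/-- The chain complex of `ℤ`-modules with the given boundary maps. -/
noncomputable abbrev complexOf : ChainComplex (ModuleCat.{u} ℤ) ℕ :=
  ChainComplex.of (fun q => ModuleCat.of ℤ (C q)) (fun q => ModuleCat.ofHom (d q)) sq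

lemma subsingleton_homology_complexOf (q : ℕ)
    (h : ∀ z, d q z = 0 → ∃ y, d (q + 1) y = z) :
    Subsingleton ((complexOf d sq).homology (q + 1)) := by
  refine ModuleCat.subsingleton_of_isZero ?_
  rw [← HomologicalComplex.exactAt_iff_isZero_homology,
    HomologicalComplex.exactAt_iff' _ (q + 2) (q + 1) q (by simp) (by simp),
    ShortComplex.moduleCat_exact_iff]
  intro z hz
  dsimp [HomologicalComplex.sc', HomologicalComplex.shortComplexFunctor'] at z hz ⊢
  rw [ChainComplex.of_d] at hz
  erw [ChainComplex.of_d]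
  exact h z hz

lemma nonempty_homology_succ_complexOf (q : ℕ) (z₀ : C (q + 1)) (hz₀ : d q z₀ = 0)
    (hgen : ∀ z, d q z = 0 → ∃ k : ℤ, ∃ y, d (q + 1) y = z - k • z₀)
    (hfree : ∀ (k : ℤ) (y), d (q + 1) y = k • z₀ → k = 0) :
    Nonempty ((complexOf d sq).homology (q + 1) ≃+ ℤ) := by
  obtain ⟨e⟩ := nonempty_homology_addEquiv_ring
    ((complexOf d sq).sc' (q + 2) (q + 1) q) z₀
    (by
      dsimp [HomologicalComplex.sc', HomologicalComplex.shortComplexFunctor']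
      rw [ChainComplex.of_d]
      exact hz₀)
    (by
      dsimp [HomologicalComplex.sc', HomologicalComplex.shortComplexFunctor']
      rw [ChainComplex.of_d]
      erw [ChainComplex.of_d]
      intro z hz
      obtain ⟨k, y, h⟩ := hgen z hz
      exact ⟨k, y, h.trans (congrArg (z - ·) (int_smul_eq_zsmul _ k z₀).symm)⟩)
    (by
      dsimp [HomologicalComplex.sc', HomologicalComplex.shortComplexFunctor']
      erw [ChainComplex.of_d]
      exact fun k y h => hfree k y (h.trans (int_smul_eq_zsmul _ k z₀)))
  exact ⟨(ShortComplex.homologyMapIso ((complexOf d sq).isoSc' (q + 2) (q + 1) q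
    (by simp) (by simp))).toLinearEquiv.toAddEquiv.trans e⟩

lemma nonempty_homology_zero_complexOf (z₀ : C 0)
    (hgen : ∀ z, ∃ k : ℤ, ∃ y, d 0 y = z - k • z₀)
    (hfree : ∀ (k : ℤ) (y), d 0 y = k • z₀ → k = 0) :
    Nonempty ((complexOf d sq).homology 0 ≃+ ℤ) := by
  obtain ⟨e⟩ := nonempty_homology_addEquiv_ring
    ((complexOf d sq).sc' 1 0 0) z₀
    (by
      dsimp [HomologicalComplex.sc', HomologicalComplex.shortComplexFunctor']
      rw [ChainComplex.of_d_ne _ _ (by simp)]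
      rfl)
    (by
      dsimp [HomologicalComplex.sc', HomologicalComplex.shortComplexFunctor']
      erw [ChainComplex.of_d]
      intro z _
      obtain ⟨k, y, h⟩ := hgen z
      exact ⟨k, y, h.trans (congrArg (z - ·) (int_smul_eq_zsmul _ k z₀).symm)⟩)
    (by
      dsimp [HomologicalComplex.sc', HomologicalComplex.shortComplexFunctor']
      erw [ChainComplex.of_d]
      exact fun k y h => hfree k y (h.trans (int_smul_eq_zsmul _ k z₀)))
  exact ⟨(ShortComplex.homologyMapIso ((complexOf d sq).isoSc' 1 0 0
    (by simp) (by simp))).toLinearEquiv.toAddEquiv.trans e⟩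

end Algebra

/-! ### Homology in degrees zero and one -/

lemma ofHom_comp_ofHom_eq_zero {A B C : Type u} [AddCommGroup A] [AddCommGroup B] [AddCommGroup C]
    [Module ℤ A] [Module ℤ B] [Module ℤ C] {f : A →ₗ[ℤ] B} {g : B →ₗ[ℤ] C} (h : g ∘ₗ f = 0) :
    ModuleCat.ofHom f ≫ ModuleCat.ofHom g = 0 := by
  rw [← ModuleCat.ofHom_comp, h]
  rfl

section Cycle

variable {C : ℕ → Type u} [∀ q, AddCommGroup (C q)] [∀ q, Module ℤ (C q)]
  (d : ∀ q, C (q + 1) →ₗ[ℤ] C q)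
  (sq : ∀ q, ModuleCat.ofHom (d (q + 1)) ≫ ModuleCat.ofHom (d q) = 0)

/-- If `C 0` is spanned by the vertices of a connected graph, adjacent vertices are homologous and
an augmentation kills the boundaries, then `H_0` is infinite cyclic. -/
lemma nonempty_homology_zero_of_connected {V : Type*} {G : SimpleGraph V} (hG : G.Connected)
    (x : V → C 0) (hspan : ⊤ ≤ Submodule.span ℤ (Set.range x))
    (ε : C 0 →ₗ[ℤ] ℤ) (hε : ∀ v, ε (x v) = 1) (hεd : ∀ y, ε (d 0 y) = 0)
    (hadj : ∀ u v, G.Adj u v → x v - x u ∈ LinearMap.range (d 0)) :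
    Nonempty ((complexOf d sq).homology 0 ≃+ ℤ) := by
  obtain ⟨v₀⟩ := hG.nonempty
  have hreach : ∀ v, x v - x v₀ ∈ LinearMap.range (d 0) := fun v => by
    obtain ⟨p⟩ := hG.preconnected v v₀
    induction p with
    | nil => rw [sub_self]; exact zero_mem _
    | cons h p ih =>
      have := sub_mem ih (hadj _ _ h)
      rwa [show ∀ a b c : C 0, b - c - (b - a) = a - c from fun a b c => by abel] at this
  refine nonempty_homology_zero_complexOf d sq (x v₀) (fun z => ?_) fun k y hy => ?_
  · have hz : z ∈ Submodule.span ℤ (Set.range x) := hspan trivial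
    induction hz using Submodule.span_induction with
    | mem z hz =>
      obtain ⟨v, rfl⟩ := hz
      obtain ⟨y, hy⟩ := hreach v
      exact ⟨1, y, by rw [hy, one_zsmul]⟩
    | zero => exact ⟨0, 0, by simp⟩
    | add z z' _ _ h h' =>
      obtain ⟨k, y, h⟩ := h
      obtain ⟨k', y', h'⟩ := h'
      exact ⟨k + k', y + y', by rw [map_add, h, h', add_zsmul]; abel⟩
    | smul a z _ h =>
      obtain ⟨k, y, h⟩ := h
      refine ⟨a * k, a • y, ?_⟩
      rw [map_zsmul, h, zsmul_sub, mul_zsmul]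
      exact congrArg (· - _) (int_smul_eq_zsmul _ a z).symm
  · have := congrArg ε hy
    rw [hεd, map_zsmul, hε] at this
    simpa using this.symm

variable {m : ℕ} [NeZero m] {x : Fin m → C 0} {e : Fin m → C 1}

/-- The sum of the consecutive edges of a cycle is a `1`-cycle. -/
lemma boundary_sum_edges (he : ∀ i, d 0 (e i) = x (i + 1) - x i) : d 0 (∑ i, e i) = 0 := by
  rw [map_sum, Finset.sum_congr rfl fun i _ => he i, Finset.sum_sub_distrib,
    sub_eq_zero]
  exact Equiv.sum_comp (Equiv.addRight (1 : Fin m)) x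

/-- If the edges of a cycle generate the `1`-chains modulo a group `B` of cycles, then every
`1`-cycle is congruent to a multiple of the whole cycle: its coefficients on consecutive edges
agree. -/
lemma exists_sub_zsmul_sum_edges_mem (he : ∀ i, d 0 (e i) = x (i + 1) - x i)
    (κ : C 0 →ₗ[ℤ] (Fin m → ℤ)) (hκ : ∀ i, κ (x i) = Pi.single i 1)
    (B : Submodule ℤ (C 1)) (hB : ∀ b ∈ B, d 0 b = 0)
    (hspan : ⊤ ≤ Submodule.span ℤ (Set.range e) ⊔ B)
    (z : C 1) (hz : d 0 z = 0) : ∃ k : ℤ, z - k • ∑ i, e i ∈ B := by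
  obtain ⟨a, ha, b, hb, rfl⟩ := Submodule.mem_sup.1 (hspan (x := z) trivial)
  obtain ⟨c, hc⟩ := (Submodule.mem_span_range_iff_exists_fun ℤ).1 ha
  replace hc : ∑ i, c i • e i = a :=
    (Finset.sum_congr rfl fun i _ => (int_smul_eq_zsmul _ (c i) (e i)).symm).trans hc
  subst hc
  rw [map_add, hB b hb, add_zero, map_sum] at hz
  have hc : ∀ i, c (i + 1) = c i := fun i => by
    have h := congrFun (congrArg κ hz) (i + 1)
    simp only [map_zsmul, he, map_sum, map_sub, hκ, Finset.sum_apply, Pi.smul_apply, Pi.sub_apply,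
      map_zero, Pi.zero_apply, smul_eq_mul, mul_sub, Finset.sum_sub_distrib, Pi.single_apply,
      add_left_inj, mul_ite, mul_one, mul_zero, Finset.sum_ite_eq, Finset.mem_univ, if_true] at h
    linarith
  have hc0 : ∀ i, c i = c 0 := by
    obtain ⟨n, rfl⟩ := Nat.exists_eq_succ_of_ne_zero (NeZero.ne m)
    intro i
    induction i using Fin.induction with
    | zero => rfl
    | succ i ih => rw [← Fin.coeSucc_eq_succ, hc, ih]
  refine ⟨c 0, ?_⟩
  have hs : c 0 • ∑ i, e i = ∑ i, c 0 • e i := map_sum (zsmulAddGroupHom (c 0)) e Finset.univ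
  rw [hs, Finset.sum_congr rfl fun i _ => by rw [hc0 i], add_sub_cancel_left]
  exact hb

/-- If in addition a winding number vanishes on boundaries, then `H_1` is infinite cyclic. -/
lemma nonempty_homology_one_of_winding (he : ∀ i, d 0 (e i) = x (i + 1) - x i)
    (κ : C 0 →ₗ[ℤ] (Fin m → ℤ)) (hκ : ∀ i, κ (x i) = Pi.single i 1)
    (hdd : ∀ y, d 0 (d 1 y) = 0)
    (hspan : ⊤ ≤ Submodule.span ℤ (Set.range e) ⊔ LinearMap.range (d 1))
    (w : C 1 →ₗ[ℤ] ℤ) (hw : ∀ i, w (e i) = 1) (hwd : ∀ y, w (d 1 y) = 0) :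
    Nonempty ((complexOf d sq).homology 1 ≃+ ℤ) := by
  refine nonempty_homology_succ_complexOf d sq 0 (∑ i, e i) (boundary_sum_edges d he)
    (exists_sub_zsmul_sum_edges_mem d he κ hκ _ (by rintro _ ⟨y, rfl⟩; exact hdd y) hspan)
    fun k y hy => ?_
  have := congrArg w hy
  rw [hwd, map_zsmul, map_sum, Finset.sum_congr rfl fun i _ => hw i] at this
  have hm : (m : ℤ) ≠ 0 := by exact_mod_cast NeZero.ne m
  rw [Finset.sum_const, Finset.card_univ, Fintype.card_fin, nsmul_one, smul_eq_mul] at this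
  exact (mul_eq_zero.1 this.symm).resolve_right hm

end Cycle

/-! ### Steps around a cycle -/

section Step

variable {n : ℕ}

lemma cycleGraph_adj_iff {u v : Fin (n + 2)} :
    (SimpleGraph.cycleGraph (n + 2)).Adj u v ↔ v = u + 1 ∨ u = v + 1 := by
  rw [SimpleGraph.cycleGraph_adj, or_comm, sub_eq_iff_eq_add', sub_eq_iff_eq_add']

/-- The signed length of the step from `u` to `v` around a cycle: `1` or `-1` when `v` comes right
after or right before `u`, and `0` otherwise. -/
def cycleStep (u v : Fin (n + 4)) : ℤ := if v = u + 1 then 1 else if u = v + 1 then -1 else 0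

lemma fin_val_add_one_cases (u : Fin (n + 4)) :
    ((u + 1 : Fin (n + 4)) : ℕ) = u + 1 ∨
      ((u + 1 : Fin (n + 4)) : ℕ) = 0 ∧ (u : ℕ) = n + 3 := by
  rw [Fin.val_add_one]
  split_ifs with h
  · right; simp [h]
  · left; rfl

@[simp] lemma cycleStep_add_one (u : Fin (n + 4)) : cycleStep u (u + 1) = 1 := if_pos rfl

lemma cycleStep_antisymm (u v : Fin (n + 4)) : cycleStep v u = -cycleStep u v := by
  unfold cycleStep
  have h : ¬ (v = u + 1 ∧ u = v + 1) := by
    rintro ⟨h1, h2⟩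
    have h1 := congrArg Fin.val h1
    have h2 := congrArg Fin.val h2
    have := fin_val_add_one_cases u
    have := fin_val_add_one_cases v
    omega
  split_ifs with h1 h2 h3
  · exact absurd ⟨h2, h1⟩ h
  all_goals norm_num

@[simp] lemma cycleStep_self (u : Fin (n + 4)) : cycleStep u u = 0 := by
  have := cycleStep_antisymm u u
  omega

lemma cycleStep_cases (u v : Fin (n + 4)) :
    cycleStep u v = 1 ∧ v = u + 1 ∨ cycleStep u v = -1 ∧ u = v + 1 ∨ cycleStep u v = 0 := by
  unfold cycleStep
  split_ifs <;> simp_all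

/-- A step between equal or adjacent points is the difference of their positions modulo the length
of the cycle. -/
lemma cycleStep_congr {u v : Fin (n + 4)}
    (h : u = v ∨ (SimpleGraph.cycleGraph (n + 4)).Adj u v) :
    ∃ k : ℤ, (v : ℤ) - (u : ℤ) = cycleStep u v + k * (n + 4) := by
  have key : ∀ u : Fin (n + 4), ∃ k : ℤ, ((u + 1 : Fin (n + 4)) : ℕ) - (u : ℤ) = 1 + k * (n + 4) :=
    fun u => by
      rcases fin_val_add_one_cases u with h | h
      · exact ⟨0, by omega⟩
      · exact ⟨-1, by omega⟩
  rcases h with rfl | h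
  · exact ⟨0, by simp⟩
  rcases cycleGraph_adj_iff.1 h with rfl | rfl
  · rw [cycleStep_add_one]; exact key u
  · obtain ⟨k, hk⟩ := key v
    rw [cycleStep_antisymm, cycleStep_add_one]
    exact ⟨-k, by linarith⟩

lemma abs_cycleStep_le (u v : Fin (n + 4)) : |cycleStep u v| ≤ 1 := by
  rcases cycleStep_cases u v with ⟨h, -⟩ | ⟨h, -⟩ | h <;> simp [h]

/-- A cycle of more than four points contains no closed walk of length four that winds around
it. -/
lemma cycleStep_sum_four {a b c e : Fin (n + 5)}
    (hab : a = b ∨ (SimpleGraph.cycleGraph (n + 5)).Adj a b)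
    (hbc : b = c ∨ (SimpleGraph.cycleGraph (n + 5)).Adj b c)
    (hce : c = e ∨ (SimpleGraph.cycleGraph (n + 5)).Adj c e)
    (hea : e = a ∨ (SimpleGraph.cycleGraph (n + 5)).Adj e a) :
    cycleStep (n := n + 1) a b + cycleStep (n := n + 1) b c + cycleStep (n := n + 1) c e +
      cycleStep (n := n + 1) e a = 0 := by
  obtain ⟨k₁, h₁⟩ := cycleStep_congr (n := n + 1) hab
  obtain ⟨k₂, h₂⟩ := cycleStep_congr (n := n + 1) hbc
  obtain ⟨k₃, h₃⟩ := cycleStep_congr (n := n + 1) hce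
  obtain ⟨k₄, h₄⟩ := cycleStep_congr (n := n + 1) hea
  have b₁ := abs_le.1 (abs_cycleStep_le (n := n + 1) a b)
  have b₂ := abs_le.1 (abs_cycleStep_le (n := n + 1) b c)
  have b₃ := abs_le.1 (abs_cycleStep_le (n := n + 1) c e)
  have b₄ := abs_le.1 (abs_cycleStep_le (n := n + 1) e a)
  refine Int.eq_zero_of_abs_lt_dvd (m := n + 5) ⟨-(k₁ + k₂ + k₃ + k₄), ?_⟩ ?_
  · push_cast at h₁ h₂ h₃ h₄
    linarith
  · rw [abs_lt]; constructor <;> linarith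

/-- A cycle of more than four points contains no four-cycle. -/
lemma cycleGraph_no_square {a b c e : Fin (n + 5)} (hac : a ≠ c) (hbe : b ≠ e)
    (hab : (SimpleGraph.cycleGraph (n + 5)).Adj a b)
    (hbc : (SimpleGraph.cycleGraph (n + 5)).Adj b c)
    (hce : (SimpleGraph.cycleGraph (n + 5)).Adj c e)
    (hea : (SimpleGraph.cycleGraph (n + 5)).Adj e a) : False := by
  have hsum := cycleStep_sum_four (.inr hab) (.inr hbc) (.inr hce) (.inr hea)
  have hpos : ∀ u v : Fin (n + 5), v = u + 1 → cycleStep (n := n + 1) u v = 1 :=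
    fun u v h => h ▸ cycleStep_add_one (n := n + 1) u
  have hneg : ∀ u v : Fin (n + 5), u = v + 1 → cycleStep (n := n + 1) u v = -1 :=
    fun u v h => by rw [cycleStep_antisymm, hpos v u h]
  have b₄ := abs_le.1 (abs_cycleStep_le (n := n + 1) e a)
  rcases cycleGraph_adj_iff.1 hab with h₁ | h₁
  · have h₂ := (cycleGraph_adj_iff.1 hbc).resolve_right
      fun h => hac (add_right_cancel (h₁.symm.trans h))
    have h₃ := (cycleGraph_adj_iff.1 hce).resolve_right
      fun h => hbe (add_right_cancel (h₂.symm.trans h))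
    rw [hpos _ _ h₁, hpos _ _ h₂, hpos _ _ h₃] at hsum
    omega
  · have h₂ := (cycleGraph_adj_iff.1 hbc).resolve_left fun h => hac (h₁.trans h.symm)
    have h₃ := (cycleGraph_adj_iff.1 hce).resolve_left fun h => hbe (h₂.trans h.symm)
    rw [hneg _ _ h₁, hneg _ _ h₂, hneg _ _ h₃] at hsum
    omega

/-- A cycle of at least four points contains no triangle. -/
lemma cycleGraph_no_triangle {a b c : Fin (n + 4)}
    (hab : (SimpleGraph.cycleGraph (n + 4)).Adj a b)
    (hbc : (SimpleGraph.cycleGraph (n + 4)).Adj b c)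
    (hca : (SimpleGraph.cycleGraph (n + 4)).Adj c a) : False := by
  have h₁ := fin_val_add_one_cases a
  have h₂ := fin_val_add_one_cases b
  have h₃ := fin_val_add_one_cases c
  simp only [cycleGraph_adj_iff, Fin.ext_iff] at hab hbc hca
  omega

end Step

/-! ### Simplicial homology -/

section Simplicial

variable {V : Type u} {G : SimpleGraph V}

lemma simplicialChain_hom_ext {q : ℕ} {M : Type*} [AddCommGroup M] [Module ℤ M]
    {f g : SimplicialChain G q →ₗ[ℤ] M} (h : ∀ x : OrderedSimplex G q, f x.toChain = g x.toChain) :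
    f = g :=
  Submodule.linearMap_qext _ (Finsupp.lhom_ext' fun x => LinearMap.ext_ring (h x))

lemma span_range_toChain (q : ℕ) :
    Submodule.span ℤ (Set.range (OrderedSimplex.toChain (G := G) (q := q))) = ⊤ := by
  rw [← Submodule.ker_mkQ (Submodule.span ℤ _), LinearMap.ker_eq_top]
  refine simplicialChain_hom_ext fun x => ?_
  rw [LinearMap.zero_apply, Submodule.mkQ_apply, Submodule.Quotient.mk_eq_zero]
  exact Submodule.subset_span ⟨x, rfl⟩

lemma linearCombination_single_one {α M : Type*} [AddCommGroup M] [Module ℤ M] (f : α → M)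
    (x : α) : Finsupp.linearCombination ℤ f (Finsupp.single x 1) = f x :=
  (Finsupp.linearCombination_single ℤ 1 x).trans (‹Module ℤ M›.one_smul (f x))

/-- The linear map on simplicial chains with prescribed values on the ordered simplices, which have
to change sign under odd reorderings. -/
noncomputable def simplicialLift {q : ℕ} {M : Type*} [AddCommGroup M] [Module ℤ M]
    (f : OrderedSimplex G q → M)
    (hf : ∀ x ρ, f x = (Equiv.Perm.sign ρ : ℤ) • f (x.permute ρ)) :
    SimplicialChain G q →ₗ[ℤ] M :=
  (simplicialRelations G q).liftQ (Finsupp.linearCombination ℤ f) <| by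
    rw [simplicialRelations, Submodule.span_le]
    rintro _ ⟨x, ρ, rfl⟩
    rw [SetLike.mem_coe, LinearMap.mem_ker, map_sub, map_zsmul, linearCombination_single_one,
      linearCombination_single_one, sub_eq_zero]
    exact hf x ρ

lemma simplicialLift_toChain {q : ℕ} {M : Type*} [AddCommGroup M] [Module ℤ M]
    (f : OrderedSimplex G q → M) (hf) (x : OrderedSimplex G q) :
    simplicialLift f hf x.toChain = f x := by
  rw [simplicialLift, OrderedSimplex.toChain]
  erw [Submodule.liftQ_apply]
  exact linearCombination_single_one f x

instance : Subsingleton (Fin (0 + 1)) := inferInstanceAs (Subsingleton (Fin 1))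

variable (G) in
/-- The `0`-simplex at a point. -/
def OrderedSimplex.vertex (v : V) : OrderedSimplex G 0 :=
  ⟨fun _ => v, fun _ _ h => absurd (Subsingleton.elim _ _) h⟩

/-- The `1`-simplex on two adjacent points. -/
def OrderedSimplex.edge {u v : V} (h : G.Adj u v) : OrderedSimplex G 1 :=
  ⟨![u, v], fun i j hij => by
    fin_cases i <;> fin_cases j <;> simp_all [G.adj_comm]⟩

lemma OrderedSimplex.eq_vertex (x : OrderedSimplex G 0) : x = .vertex G (x.1 0) :=
  Subtype.ext (funext fun i => by rw [Subsingleton.elim i 0]; rfl)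

lemma OrderedSimplex.boundary_one (x : OrderedSimplex G 1) :
    x.boundary = (vertex G (x.1 1)).toChain - (vertex G (x.1 0)).toChain := by
  rw [OrderedSimplex.boundary, Fin.sum_univ_two, (x.face 0).eq_vertex, (x.face 1).eq_vertex]
  simp only [Fin.val_zero, pow_zero, one_smul, Fin.val_one, pow_one, neg_smul, ← sub_eq_add_neg]
  rfl

lemma simplicialBoundary_edge {u v : V} (h : G.Adj u v) :
    simplicialBoundary G 0 (OrderedSimplex.edge h).toChain =
      (OrderedSimplex.vertex G v).toChain - (OrderedSimplex.vertex G u).toChain := by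
  rw [simplicialBoundary_toChain, OrderedSimplex.boundary_one]
  rfl

lemma sign_perm_fin_one (ρ : Equiv.Perm (Fin (0 + 1))) : (Equiv.Perm.sign ρ : ℤ) = 1 := by
  rw [Subsingleton.elim ρ 1]; simp

lemma top_le_span_vertex :
    ⊤ ≤ Submodule.span ℤ (Set.range fun v => (OrderedSimplex.vertex G v).toChain) := by
  rw [← span_range_toChain, Submodule.span_le]
  rintro _ ⟨x, rfl⟩
  rw [x.eq_vertex]
  exact Submodule.subset_span ⟨_, rfl⟩

/-- The simplicial homology of a connected image is infinite cyclic in degree `0`. -/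
theorem simplicialHomology_zero (hG : G.Connected) :
    Nonempty (simplicialHomology G 0 ≃+ ℤ) := by
  let ε : SimplicialChain G 0 →ₗ[ℤ] ℤ := simplicialLift (fun _ => 1) fun x ρ => by
    rw [sign_perm_fin_one, one_smul]
  have hε : ∀ x : OrderedSimplex G 0, ε x.toChain = 1 := fun x => simplicialLift_toChain _ _ x
  have hεd : ε ∘ₗ simplicialBoundary G 0 = 0 := simplicialChain_hom_ext fun x => by
    rw [LinearMap.comp_apply, simplicialBoundary_toChain, OrderedSimplex.boundary_one, map_sub,
      hε, hε, sub_self, LinearMap.zero_apply]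
  exact nonempty_homology_zero_of_connected (simplicialBoundary G)
    (fun q => ofHom_comp_ofHom_eq_zero (simplicialBoundary_comp G q)) hG _ top_le_span_vertex ε
    (fun v => hε _) (LinearMap.congr_fun hεd) fun u v h => ⟨_, simplicialBoundary_edge h⟩

lemma OrderedSimplex.toChain_edge_symm {u v : V} (h : G.Adj u v) :
    (edge h.symm).toChain = -(edge h).toChain := by
  rw [(edge h).toChain_permute (Equiv.swap 0 1), Equiv.Perm.sign_swap (by simp)]
  have : (edge h).permute (Equiv.swap 0 1) = edge h.symm :=
    Subtype.ext (funext fun i => by fin_cases i <;> rfl)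
  rw [this]
  simp

/-! ### Simplicial homology of cycles -/

lemma isEmpty_orderedSimplex_cycleGraph (n q : ℕ) :
    IsEmpty (OrderedSimplex (SimpleGraph.cycleGraph (n + 4)) (q + 2)) := by
  refine ⟨fun x => ?_⟩
  have h := fun (i j : ℕ) (hi : i < 3) (hj : j < 3) (hij : i ≠ j) =>
    x.2 ⟨i, by omega⟩ ⟨j, by omega⟩ (by simpa using hij)
  exact cycleGraph_no_triangle (h 0 1 (by simp) (by simp) (by simp))
    (h 1 2 (by simp) (by simp) (by simp)) (h 2 0 (by simp) (by simp) (by simp))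

lemma subsingleton_simplicialChain_cycleGraph (n q : ℕ) :
    Subsingleton (SimplicialChain (SimpleGraph.cycleGraph (n + 4)) (q + 2)) := by
  have := isEmpty_orderedSimplex_cycleGraph n q
  exact (Submodule.Quotient.mk_surjective _).subsingleton

/-- A cycle of at least four points has no simplicial homology above degree `1`, as it contains no
triangles. -/
theorem simplicialHomology_cycleGraph_add_two (n q : ℕ) :
    Subsingleton (simplicialHomology (SimpleGraph.cycleGraph (n + 4)) (q + 2)) := by
  have := subsingleton_simplicialChain_cycleGraph n q
  exact subsingleton_homology_complexOf (simplicialBoundary _)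
    (fun q => ofHom_comp_ofHom_eq_zero (simplicialBoundary_comp _ q)) (q + 1) fun z _ =>
    ⟨0, Subsingleton.elim _ _⟩

/-- The first simplicial homology of a cycle of at least four points is infinite cyclic. -/
theorem simplicialHomology_cycleGraph_one (n : ℕ) :
    Nonempty (simplicialHomology (SimpleGraph.cycleGraph (n + 4)) 1 ≃+ ℤ) := by
  have h2 := subsingleton_simplicialChain_cycleGraph n 0
  let G := SimpleGraph.cycleGraph (n + 4)
  have hadj : ∀ i, G.Adj i (i + 1) := fun i => cycleGraph_adj_iff.2 (.inl rfl)
  let κ : SimplicialChain G 0 →ₗ[ℤ] (Fin (n + 4) → ℤ) :=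
    simplicialLift (fun x => Pi.single (x.1 0) 1) fun x ρ => by
      rw [sign_perm_fin_one, one_smul, Subsingleton.elim ρ 1]
      rfl
  have hperm : ∀ ρ : Equiv.Perm (Fin (1 + 1)), ρ = 1 ∨ ρ = Equiv.swap 0 1 := by decide
  let w : SimplicialChain G 1 →ₗ[ℤ] ℤ :=
    simplicialLift (fun x => cycleStep (x.1 0) (x.1 1)) fun x ρ => by
      rcases hperm ρ with rfl | rfl
      · simp [OrderedSimplex.permute]
      · simp [OrderedSimplex.permute, cycleStep_antisymm (x.1 0) (x.1 1)]
  refine nonempty_homology_one_of_winding (simplicialBoundary G)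
    (fun q => ofHom_comp_ofHom_eq_zero (simplicialBoundary_comp G q))
    (fun i => simplicialBoundary_edge (hadj i)) κ
    (fun i => simplicialLift_toChain _ _ (OrderedSimplex.vertex G i))
    (fun y => LinearMap.congr_fun (simplicialBoundary_comp G 0) y) ?_ w
    (fun i => (simplicialLift_toChain _ _ _).trans (cycleStep_add_one i))
    (fun y => by rw [Subsingleton.elim y 0, map_zero, map_zero])
  refine le_trans ?_ le_sup_left
  rw [← span_range_toChain, Submodule.span_le]
  rintro _ ⟨x, rfl⟩
  have hx : G.Adj (x.1 0) (x.1 1) := x.2 0 1 (by simp)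
  have hxe : x = .edge hx := Subtype.ext (funext fun i => by fin_cases i <;> rfl)
  rcases cycleGraph_adj_iff.1 hx with h | h
  · refine Submodule.subset_span ⟨x.1 0, congrArg OrderedSimplex.toChain ?_⟩
    rw [hxe]
    exact Subtype.ext (funext fun i => by fin_cases i; exacts [rfl, h.symm])
  · have hy : OrderedSimplex.edge hx.symm = .edge (hadj (x.1 1)) :=
      Subtype.ext (funext fun i => by fin_cases i; exacts [rfl, h])
    rw [hxe, ← neg_neg (OrderedSimplex.edge hx).toChain, ← OrderedSimplex.toChain_edge_symm, hy]
    exact neg_mem (Submodule.subset_span ⟨_, rfl⟩)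

/-! ### Cones -/

/-- The simplex `⟨v, x₀, …, x_q⟩`. -/
def OrderedSimplex.cons {q : ℕ} (v : V) (x : OrderedSimplex G q) (h : ∀ i, G.Adj v (x.1 i)) :
    OrderedSimplex G (q + 1) :=
  ⟨Fin.cons v x.1, fun i j => by
    refine Fin.cases ?_ (fun i => ?_) i <;> refine Fin.cases ?_ (fun j => ?_) j
    · exact fun h => absurd rfl h
    · exact fun _ => h j
    · exact fun _ => (h i).symm
    · exact fun hij => x.2 i j fun e => hij (congrArg Fin.succ e)⟩

lemma OrderedSimplex.permute_cons {q : ℕ} (v : V) (x : OrderedSimplex G q) (h)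
    (ρ : Equiv.Perm (Fin (q + 1))) :
    (x.cons v h).permute (Equiv.Perm.decomposeFin.symm (0, ρ)) =
      (x.permute ρ).cons v fun i => h (ρ i) := by
  refine Subtype.ext (funext fun i => ?_)
  refine Fin.cases ?_ (fun i => ?_) i
  · simp [permute, cons]
  · simp [permute, cons]

lemma OrderedSimplex.face_zero_cons {q : ℕ} (v : V) (x : OrderedSimplex G q) (h) :
    (x.cons v h).face 0 = x :=
  Subtype.ext (funext fun i => by simp [face, cons])

lemma OrderedSimplex.face_succ_cons {q : ℕ} (v : V) (x : OrderedSimplex G (q + 1)) (h)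
    (i : Fin (q + 2)) :
    (x.cons v h).face i.succ = (x.face i).cons v fun k => h (i.succAbove k) := by
  refine Subtype.ext (funext fun k => ?_)
  refine Fin.cases ?_ (fun k => ?_) k
  · simp [face, cons]
  · simp [face, cons]

open Classical in
/-- The value on an ordered simplex of the cone operator with apex `v`: the point `v` is put in
front of the simplex, and the result is `0` if it is a vertex already. -/
noncomputable def OrderedSimplex.cone {v : V} (hv : ∀ w, w ≠ v → G.Adj v w) {q : ℕ}
    (x : OrderedSimplex G q) : SimplicialChain G (q + 1) :=
  if h : ∀ i, x.1 i ≠ v then (x.cons v fun i => hv _ (h i)).toChain else 0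

variable {v : V} (hv : ∀ w, w ≠ v → G.Adj v w)

lemma OrderedSimplex.cone_permute {q : ℕ} (x : OrderedSimplex G q)
    (ρ : Equiv.Perm (Fin (q + 1))) :
    x.cone hv = (Equiv.Perm.sign ρ : ℤ) • (x.permute ρ).cone hv := by
  by_cases h : ∀ i, x.1 i ≠ v
  · have h' : ∀ i, (x.permute ρ).1 i ≠ v := fun i => h (ρ i)
    rw [cone, cone, dif_pos h, dif_pos h',
      toChain_permute _ (Equiv.Perm.decomposeFin.symm (0, ρ)), permute_cons,
      Equiv.Perm.decomposeFin.symm_sign, if_pos rfl, one_mul]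
  · have h' : ¬ ∀ i, (x.permute ρ).1 i ≠ v := fun h' => h fun i => by
      have := h' (ρ⁻¹ i)
      simpa [permute] using this
    rw [cone, cone, dif_neg h, dif_neg h', smul_zero]

/-- The cone operator is a contracting homotopy: `∂⟨v, x⟩ = x - ⟨v, ∂x⟩`. When `v` is the vertex
of index `k` of `x`, the only term of `∂x` whose cone does not vanish is the one that omits `v`,
and its cone is `x` up to a cyclic reordering of the points. -/
lemma OrderedSimplex.boundary_cone {q : ℕ} (x : OrderedSimplex G (q + 1)) :
    simplicialBoundary G (q + 1) (x.cone hv) =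
      x.toChain - ∑ i : Fin (q + 2), (-1 : ℤ) ^ (i : ℕ) • (x.face i).cone hv := by
  by_cases h : ∀ i, x.1 i ≠ v
  · rw [cone, dif_pos h, simplicialBoundary_toChain, boundary, Fin.sum_univ_succ, face_zero_cons,
      Fin.val_zero, pow_zero, one_smul, sub_eq_add_neg, ← Finset.sum_neg_distrib]
    congr 1
    refine Finset.sum_congr rfl fun i _ => ?_
    have h' : ∀ k, (x.face i).1 k ≠ v := fun k => h _
    rw [face_succ_cons, cone, dif_pos h', Fin.val_succ, pow_succ, mul_neg_one, neg_smul]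
  · rw [cone, dif_neg h, map_zero, eq_comm, sub_eq_zero]
    push Not at h
    obtain ⟨k, hk⟩ := h
    have hinj : ∀ i, x.1 i = v → i = k := fun i hi => by
      by_contra hne
      exact (x.2 i k hne).ne (hi.trans hk.symm)
    rw [Finset.sum_eq_single k]
    · have h' : ∀ i, (x.face k).1 i ≠ v := fun i hi =>
        Fin.succAbove_ne k i (hinj _ hi)
      rw [cone, dif_pos h', x.toChain_permute k.cycleRange.symm, Equiv.Perm.sign_symm,
        Fin.sign_cycleRange]
      have : x.permute k.cycleRange.symm = (x.face k).cons v fun i => hv _ (h' i) := by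
        refine Subtype.ext (funext fun i => ?_)
        refine Fin.cases ?_ (fun i => ?_) i
        · simp [permute, cons, hk]
        · simp [permute, cons, face]
      rw [this]
      push_cast
      rfl
    · intro i _ hi
      obtain ⟨j, hj⟩ := Fin.exists_succAbove_eq hi.symm
      rw [cone, dif_neg, smul_zero]
      exact fun h => h j ((congrArg x.1 hj).trans hk)
    · exact fun h => absurd (Finset.mem_univ _) h

include hv in
/-- An image with a point adjacent to all others has no simplicial homology in positive
degrees. -/
theorem simplicialHomology_succ_of_cone (q : ℕ) :
    Subsingleton (simplicialHomology G (q + 1)) := by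
  let h : ∀ q, SimplicialChain G q →ₗ[ℤ] SimplicialChain G (q + 1) := fun q =>
    simplicialLift (fun x => x.cone hv) fun x ρ => x.cone_permute hv ρ
  have hh : ∀ q (x : OrderedSimplex G q), h q x.toChain = x.cone hv := fun q x =>
    simplicialLift_toChain _ _ x
  have key : simplicialBoundary G (q + 1) ∘ₗ h (q + 1) =
      LinearMap.id - h q ∘ₗ simplicialBoundary G q := simplicialChain_hom_ext fun x => by
    simp only [LinearMap.comp_apply, LinearMap.sub_apply, LinearMap.id_apply, hh,
      simplicialBoundary_toChain, x.boundary_cone hv, OrderedSimplex.boundary, map_sum, map_smul]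
  refine subsingleton_homology_complexOf (simplicialBoundary G)
    (fun q => ofHom_comp_ofHom_eq_zero (simplicialBoundary_comp G q)) q fun z hz => ⟨h _ z, ?_⟩
  have := LinearMap.congr_fun key z
  simpa [hz] using this

end Simplicial

/-! ### Cubical homology -/

section Cubical

lemma latticeGraph_one_adj {n : ℕ} {x y : Fin n → ℤ} :
    (latticeGraph n 1).Adj x y ↔ ∃ i, |x i - y i| = 1 ∧ ∀ j, j ≠ i → x j = y j := by
  constructor
  · rintro ⟨hne, hle, hcard⟩
    obtain ⟨i, hi⟩ := Function.ne_iff.1 hne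
    refine ⟨i, le_antisymm (hle i) (Int.one_le_abs (sub_ne_zero.2 hi)), fun j hj => ?_⟩
    by_contra h
    exact hj (Finset.card_le_one.1 hcard j (by simpa using h) i (by simpa using hi))
  · rintro ⟨i, hi, h⟩
    have hne : x i ≠ y i := fun e => by simp [e] at hi
    refine ⟨fun e => hne (congrFun e i), fun j => ?_, ?_⟩
    · rcases eq_or_ne j i with rfl | hj
      · exact hi.le
      · simp [h j hj]
    · refine Finset.card_le_one.2 fun a ha b hb => ?_
      have key : ∀ a, a ∈ Finset.univ.filter (fun i => x i ≠ y i) → a = i := fun a ha => by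
        by_contra hai
        exact (Finset.mem_filter.1 ha).2 (h a hai)
      rw [key a ha, key b hb]

lemma unitCube_adj {q : ℕ} {s t : Fin q → Fin 2} :
    (unitCube q).Adj s t ↔ ∃ i, s i ≠ t i ∧ ∀ j, j ≠ i → s j = t j := by
  have h1 : ∀ a b : Fin 2, |((a : ℕ) : ℤ) - ((b : ℕ) : ℤ)| = 1 ↔ a ≠ b := by decide
  have h2 : ∀ a b : Fin 2, ((a : ℕ) : ℤ) = ((b : ℕ) : ℤ) ↔ a = b := by decide
  rw [unitCube, SimpleGraph.comap_adj, latticeGraph_one_adj]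
  simp only [h1, h2]

variable {V : Type u} {G : SimpleGraph V}

lemma cubicalChain_hom_ext {q : ℕ} {M : Type*} [AddCommGroup M] [Module ℤ M]
    {f g : CubicalChain G q →ₗ[ℤ] M} (h : ∀ σ : Cube G q, f σ.toChain = g σ.toChain) : f = g :=
  Submodule.linearMap_qext _ (Finsupp.lhom_ext' fun σ => LinearMap.ext_ring (h σ))

lemma span_range_cube_toChain (q : ℕ) :
    Submodule.span ℤ (Set.range (Cube.toChain (G := G) (q := q))) = ⊤ := by
  rw [← Submodule.ker_mkQ (Submodule.span ℤ _), LinearMap.ker_eq_top]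
  refine cubicalChain_hom_ext fun x => ?_
  rw [LinearMap.zero_apply, Submodule.mkQ_apply, Submodule.Quotient.mk_eq_zero]
  exact Submodule.subset_span ⟨x, rfl⟩

/-- The linear map on cubical chains with prescribed values on the cubes, which have to vanish on
the degenerate ones. -/
noncomputable def cubicalLift {q : ℕ} {M : Type*} [AddCommGroup M] [Module ℤ M]
    (f : Cube G q → M) (hf : ∀ σ : Cube G q, σ.IsDegenerate → f σ = 0) :
    CubicalChain G q →ₗ[ℤ] M :=
  (degenerateChains G q).liftQ (Finsupp.linearCombination ℤ f) <| by
    rw [degenerateChains, Submodule.span_le]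
    rintro _ ⟨σ, h, rfl⟩
    rw [SetLike.mem_coe, LinearMap.mem_ker, linearCombination_single_one, hf σ h]

lemma cubicalLift_toChain {q : ℕ} {M : Type*} [AddCommGroup M] [Module ℤ M]
    (f : Cube G q → M) (hf) (σ : Cube G q) : cubicalLift f hf σ.toChain = f σ := by
  rw [cubicalLift, Cube.toChain]
  erw [Submodule.liftQ_apply]
  exact linearCombination_single_one f σ

/-! ### Homotopy invariance of cubical homology -/

lemma IsDigitallyContinuous.eq_or_adj {W : Type*} {H : SimpleGraph W} {f : V → W}
    (hf : IsDigitallyContinuous G H f) {x y : V} (h : x = y ∨ G.Adj x y) :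
    f x = f y ∨ H.Adj (f x) (f y) :=
  h.elim (fun e => .inl (congrArg f e)) fun e => hf e

/-- The image of a cube under a continuous self-map. -/
def Cube.map {q : ℕ} {f : V → V} (hf : IsDigitallyContinuous G G f) (σ : Cube G q) : Cube G q :=
  ⟨fun t => f (σ.1 t), fun _ _ h => hf.eq_or_adj (σ.2 h)⟩

lemma Cube.IsDegenerate.map {q : ℕ} {f : V → V} (hf : IsDigitallyContinuous G G f)
    {σ : Cube G q} (h : σ.IsDegenerate) : (σ.map hf).IsDegenerate := by
  obtain ⟨i, hi⟩ := h
  exact ⟨i, fun t a => congrArg f (hi t a)⟩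

/-- The map induced on cubical chains by a continuous self-map. -/
noncomputable def cubicalMap {f : V → V} (hf : IsDigitallyContinuous G G f) (q : ℕ) :
    CubicalChain G q →ₗ[ℤ] CubicalChain G q :=
  cubicalLift (fun σ => (σ.map hf).toChain) fun _ h => Cube.toChain_eq_zero (h.map hf)

lemma cubicalMap_toChain {f : V → V} (hf : IsDigitallyContinuous G G f) {q : ℕ} (σ : Cube G q) :
    cubicalMap hf q σ.toChain = (σ.map hf).toChain :=
  cubicalLift_toChain _ _ σ

/-- The prism over a cube traced by the two stages `F 0`, `F 1` of a homotopy. -/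
def Cube.prism {q : ℕ} {F : Fin 2 → V → V} (hF : ∀ ε, IsDigitallyContinuous G G (F ε))
    (hclose : ∀ v, F 0 v = F 1 v ∨ G.Adj (F 0 v) (F 1 v)) (σ : Cube G q) : Cube G (q + 1) :=
  ⟨fun t => F (t 0) (σ.1 (Fin.tail t)), fun s t h => by
    obtain ⟨i, hi, hij⟩ := unitCube_adj.1 h
    change F (s 0) (σ.1 (Fin.tail s)) = F (t 0) (σ.1 (Fin.tail t)) ∨
      G.Adj (F (s 0) (σ.1 (Fin.tail s))) (F (t 0) (σ.1 (Fin.tail t)))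
    rcases Fin.eq_zero_or_eq_succ i with rfl | ⟨i, rfl⟩
    · have htail : Fin.tail s = Fin.tail t := funext fun k => hij _ (Fin.succ_ne_zero k)
      have h2 : ∀ a b : Fin 2, a ≠ b → a = 0 ∧ b = 1 ∨ a = 1 ∧ b = 0 := by decide
      rw [htail]
      rcases h2 _ _ hi with ⟨h0, h1⟩ | ⟨h1, h0⟩ <;> rw [h0, h1]
      · exact hclose _
      · exact (hclose _).imp Eq.symm SimpleGraph.Adj.symm
    · rw [hij 0 (Fin.succ_ne_zero i).symm]
      refine (hF _).eq_or_adj (σ.2 (unitCube_adj.2 ⟨i, hi, fun j hj => hij _ ?_⟩))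
      exact fun e => hj (Fin.succ_injective _ e)⟩

section Prism

variable {F : Fin 2 → V → V} (hF : ∀ ε, IsDigitallyContinuous G G (F ε))
  (hclose : ∀ v, F 0 v = F 1 v ∨ G.Adj (F 0 v) (F 1 v))

lemma Cube.IsDegenerate.prism {q : ℕ} {σ : Cube G q} (h : σ.IsDegenerate) :
    (σ.prism hF hclose).IsDegenerate := by
  obtain ⟨i, hi⟩ := h
  refine ⟨i.succ, fun t a => ?_⟩
  change F (Function.update t i.succ a 0) (σ.1 (Fin.tail (Function.update t i.succ a))) = _
  rw [Fin.tail_update_succ, hi, Function.update_of_ne (Fin.succ_ne_zero i).symm]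
  rfl

lemma Cube.face_zero_prism {q : ℕ} (σ : Cube G q) (ε : Fin 2) :
    (σ.prism hF hclose).face ε 0 = σ.map (hF ε) := by
  refine Subtype.ext (funext fun t => ?_)
  change F ((Fin.insertNth 0 ε t : Fin (q + 1) → Fin 2) 0)
    (σ.1 (Fin.tail (Fin.insertNth 0 ε t : Fin (q + 1) → Fin 2))) = F ε (σ.1 t)
  rw [Fin.insertNth_zero', Fin.cons_zero, Fin.tail_cons]

lemma Cube.face_succ_prism {q : ℕ} (σ : Cube G (q + 1)) (ε : Fin 2) (i : Fin (q + 1)) :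
    (σ.prism hF hclose).face ε i.succ = (σ.face ε i).prism hF hclose := by
  refine Subtype.ext (funext fun t => ?_)
  change F ((i.succ.insertNth ε t : Fin (q + 2) → Fin 2) 0)
    (σ.1 (Fin.tail (i.succ.insertNth ε t : Fin (q + 2) → Fin 2))) =
      F (t 0) (σ.1 (i.insertNth ε (Fin.tail t)))
  have h0 : (i.succ.insertNth ε t : Fin (q + 2) → Fin 2) 0 = t 0 := by
    rw [← Fin.succ_succAbove_zero i, Fin.insertNth_apply_succAbove]
  have h1 : Fin.tail (i.succ.insertNth ε t : Fin (q + 2) → Fin 2) =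
      i.insertNth ε (Fin.tail t) := by
    funext k
    refine Fin.succAboveCases i ?_ (fun k => ?_) k
    · rw [Fin.tail, Fin.insertNth_apply_same, Fin.insertNth_apply_same]
    · rw [Fin.tail, ← Fin.succ_succAbove_succ, Fin.insertNth_apply_succAbove,
        Fin.insertNth_apply_succAbove, Fin.tail]
  rw [h0, h1]

include hF hclose in
/-- The two stages of a homotopy map a cycle of positive degree to homologous cycles. -/
lemma exists_boundary_eq_cubicalMap_sub {q : ℕ} (z : CubicalChain G (q + 1))
    (hz : cubicalBoundary G q z = 0) :
    ∃ y, cubicalBoundary G (q + 1) y = cubicalMap (hF 1) _ z - cubicalMap (hF 0) _ z := by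
  let h : ∀ q, CubicalChain G q →ₗ[ℤ] CubicalChain G (q + 1) := fun q =>
    cubicalLift (fun σ => (σ.prism hF hclose).toChain)
      fun _ h => Cube.toChain_eq_zero (h.prism hF hclose)
  have hh : ∀ q (σ : Cube G q), h q σ.toChain = (σ.prism hF hclose).toChain := fun q σ =>
    cubicalLift_toChain _ _ σ
  have key : cubicalBoundary G (q + 1) ∘ₗ h (q + 1) =
      cubicalMap (hF 1) _ - cubicalMap (hF 0) _ - h q ∘ₗ cubicalBoundary G q :=
    cubicalChain_hom_ext fun σ => by
      simp only [LinearMap.comp_apply, LinearMap.sub_apply, hh, cubicalBoundary_toChain,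
        cubicalMap_toChain, Cube.boundary, map_sum, map_smul, map_sub]
      rw [Fin.sum_univ_succ, Cube.face_zero_prism, Cube.face_zero_prism, sub_eq_add_neg _ (∑ i, _),
        ← Finset.sum_neg_distrib]
      congr 1
      · simp
      · refine Finset.sum_congr rfl fun i _ => ?_
        rw [Cube.face_succ_prism, Cube.face_succ_prism, Fin.val_succ, pow_succ, mul_neg_one,
          neg_smul]
  refine ⟨h _ z, ?_⟩
  have := LinearMap.congr_fun key z
  simpa [hz] using this

end Prism

lemma isDigitallyContinuous_const (v : V) : IsDigitallyContinuous G G fun _ => v :=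
  fun _ _ _ => .inl rfl

lemma cubicalMap_const (v : V) (q : ℕ) :
    cubicalMap (isDigitallyContinuous_const (G := G) v) (q + 1) = 0 :=
  cubicalChain_hom_ext fun σ => by
    rw [cubicalMap_toChain, LinearMap.zero_apply]
    exact Cube.toChain_eq_zero ⟨0, fun _ _ => rfl⟩

lemma isDigitallyContinuous_id : IsDigitallyContinuous G G fun v => v :=
  fun _ _ h => .inr h

lemma cubicalMap_id (q : ℕ) :
    cubicalMap (isDigitallyContinuous_id (G := G)) q = LinearMap.id :=
  cubicalChain_hom_ext fun σ => by rw [cubicalMap_toChain]; rfl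

/-- An image that can be contracted to a point in two steps, through a self-map `f`, has no cubical
homology in positive degrees. -/
theorem cubicalHomology_succ_of_contractible {f : V → V} (hf : IsDigitallyContinuous G G f)
    (hid : ∀ v, v = f v ∨ G.Adj v (f v)) (v₀ : V) (hconst : ∀ v, f v = v₀ ∨ G.Adj (f v) v₀)
    (q : ℕ) : Subsingleton (cubicalHomology G (q + 1)) := by
  refine subsingleton_homology_complexOf (cubicalBoundary G)
    (fun q => ofHom_comp_ofHom_eq_zero (cubicalBoundary_comp G q)) q fun z hz => ?_
  obtain ⟨y, hy⟩ := exists_boundary_eq_cubicalMap_sub (F := ![fun v => v, f])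
    (Fin.forall_fin_two.2 ⟨isDigitallyContinuous_id, hf⟩) hid z hz
  obtain ⟨y', hy'⟩ := exists_boundary_eq_cubicalMap_sub (F := ![f, fun _ => v₀])
    (Fin.forall_fin_two.2 ⟨hf, isDigitallyContinuous_const v₀⟩) hconst z hz
  have h₀ : cubicalMap isDigitallyContinuous_id (q + 1) z = z := by rw [cubicalMap_id]; rfl
  have h₁ : cubicalMap (isDigitallyContinuous_const (G := G) v₀) (q + 1) z = 0 := by
    rw [cubicalMap_const]; rfl
  refine ⟨-(y + y'), ?_⟩
  rw [map_neg, map_add, hy, hy']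
  change -((cubicalMap hf _ z - cubicalMap isDigitallyContinuous_id _ z) +
    (cubicalMap (isDigitallyContinuous_const v₀) _ z - cubicalMap hf _ z)) = z
  rw [h₀, h₁]
  abel

/-- The cycles of at most four points are contractible: `f` folds the last two points of a
four-point cycle onto the first two. -/
theorem cubicalHomology_cycleGraph_succ {m : ℕ} (h1 : 1 ≤ m) (h4 : m ≤ 4) (q : ℕ) :
    Subsingleton (cubicalHomology (SimpleGraph.cycleGraph m) (q + 1)) := by
  interval_cases m
  · exact cubicalHomology_succ_of_contractible (f := fun v => v) isDigitallyContinuous_id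
      (fun _ => .inl rfl) 0 (by decide) q
  · exact cubicalHomology_succ_of_contractible (f := fun v => v) isDigitallyContinuous_id
      (fun _ => .inl rfl) 0 (by decide) q
  · exact cubicalHomology_succ_of_contractible (f := fun v => v) isDigitallyContinuous_id
      (fun _ => .inl rfl) 0 (by decide) q
  · refine cubicalHomology_succ_of_contractible (f := ![0, 1, 1, 0]) ?_ (by decide) 0 (by decide) q
    unfold IsDigitallyContinuous
    decide

/-! ### Cubical chains in degrees `0` and `1` -/

variable (G) in
/-- The `0`-cube at a point. -/
def Cube.vertex (v : V) : Cube G 0 := ⟨fun _ => v, fun _ _ _ => .inl rfl⟩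

/-- The `1`-cube from `u` to `v`. -/
def Cube.edge {u v : V} (h : u = v ∨ G.Adj u v) : Cube G 1 :=
  ⟨fun t => if t 0 = 0 then u else v, fun s t _ => by
    dsimp only
    split_ifs
    · exact .inl rfl
    · exact h
    · exact h.imp Eq.symm SimpleGraph.Adj.symm
    · exact .inl rfl⟩

lemma Cube.eq_vertex (σ : Cube G 0) : σ = .vertex G (σ.1 0) :=
  Subtype.ext (funext fun _ => congrArg σ.1 (Subsingleton.elim _ _))

lemma Cube.boundary_one (σ : Cube G 1) :
    σ.boundary = (vertex G (σ.1 fun _ => 1)).toChain - (vertex G (σ.1 fun _ => 0)).toChain := by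
  rw [Cube.boundary, Fin.sum_univ_one, (σ.face 0 0).eq_vertex, (σ.face 1 0).eq_vertex]
  have h : ∀ ε : Fin 2, (σ.face ε 0).1 0 = σ.1 fun _ => ε := fun ε =>
    congrArg σ.1 (funext fun i => by rw [Subsingleton.elim i 0, Fin.insertNth_apply_same])
  rw [h, h]
  simp

lemma cubicalBoundary_edge {u v : V} (h : u = v ∨ G.Adj u v) :
    cubicalBoundary G 0 (Cube.edge h).toChain =
      (Cube.vertex G v).toChain - (Cube.vertex G u).toChain := by
  rw [cubicalBoundary_toChain, Cube.boundary_one]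
  rfl

lemma top_le_span_cube_vertex :
    ⊤ ≤ Submodule.span ℤ (Set.range fun v => (Cube.vertex G v).toChain) := by
  rw [← span_range_cube_toChain, Submodule.span_le]
  rintro _ ⟨x, rfl⟩
  rw [x.eq_vertex]
  exact Submodule.subset_span ⟨_, rfl⟩

lemma Cube.not_isDegenerate_zero (σ : Cube G 0) : ¬ σ.IsDegenerate := fun ⟨i, _⟩ => i.elim0

/-- The cubical homology of a connected image is infinite cyclic in degree `0`. -/
theorem cubicalHomology_zero (hG : G.Connected) : Nonempty (cubicalHomology G 0 ≃+ ℤ) := by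
  let ε : CubicalChain G 0 →ₗ[ℤ] ℤ :=
    cubicalLift (fun _ => 1) fun σ h => absurd h σ.not_isDegenerate_zero
  have hε : ∀ σ : Cube G 0, ε σ.toChain = 1 := fun σ => cubicalLift_toChain _ _ σ
  have hεd : ε ∘ₗ cubicalBoundary G 0 = 0 := cubicalChain_hom_ext fun σ => by
    rw [LinearMap.comp_apply, cubicalBoundary_toChain, Cube.boundary_one, map_sub, hε, hε,
      sub_self, LinearMap.zero_apply]
  exact nonempty_homology_zero_of_connected (cubicalBoundary G)
    (fun q => ofHom_comp_ofHom_eq_zero (cubicalBoundary_comp G q)) hG _ top_le_span_cube_vertex ε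
    (fun v => hε _) (LinearMap.congr_fun hεd) fun u v h => ⟨_, cubicalBoundary_edge (.inr h)⟩

lemma Cube.eq_or_adj_one (σ : Cube G 1) :
    (σ.1 fun _ => 0) = (σ.1 fun _ => 1) ∨ G.Adj (σ.1 fun _ => 0) (σ.1 fun _ => 1) :=
  σ.2 (unitCube_adj.2 ⟨0, by simp, fun j hj => absurd (Subsingleton.elim _ _) hj⟩)

lemma Cube.eq_edge (σ : Cube G 1) : σ = .edge σ.eq_or_adj_one := by
  refine Subtype.ext (funext fun t => ?_)
  change _ = if t 0 = 0 then _ else _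
  split_ifs with h
  · exact congrArg σ.1 (funext fun i => by rw [Subsingleton.elim i 0, h])
  · exact congrArg σ.1 (funext fun i => by
      rw [Subsingleton.elim i 0, Fin.eq_one_of_ne_zero _ h])

lemma Cube.isDegenerate_edge_self (v : V) : (edge (G := G) (.inl (Eq.refl v))).IsDegenerate :=
  ⟨0, fun t a => by simp [edge]⟩

lemma Cube.face_zero_two (τ : Cube G 2) (ε a : Fin 2) :
    ((τ.face ε 0).1 fun _ => a) = τ.1 ![ε, a] :=
  congrArg τ.1 (funext fun i => by fin_cases i <;> rfl)

lemma Cube.face_one_two (τ : Cube G 2) (ε a : Fin 2) :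
    ((τ.face ε 1).1 fun _ => a) = τ.1 ![a, ε] :=
  congrArg τ.1 (funext fun i => by fin_cases i <;> rfl)

lemma Cube.boundary_two (τ : Cube G 2) :
    τ.boundary = (τ.face 0 1).toChain + (τ.face 1 0).toChain -
      ((τ.face 1 1).toChain + (τ.face 0 0).toChain) := by
  rw [Cube.boundary, Fin.sum_univ_two]
  simp only [Fin.val_zero, Fin.val_one, zero_add, pow_one, neg_smul, one_smul]
  norm_num
  abel

/-- Going along an edge and back bounds a square. -/
lemma toChain_edge_add_symm_mem_range {u v : V} (h : G.Adj u v) :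
    (Cube.edge (.inr h)).toChain + (Cube.edge (.inr h.symm)).toChain ∈
      LinearMap.range (cubicalBoundary G 1) := by
  let τ : Cube G 2 := ⟨fun t => if t 0 = 1 ∧ t 1 = 0 then v else u, fun s t _ => by
    dsimp only
    split_ifs
    · exact .inl rfl
    · exact .inr h.symm
    · exact .inr h
    · exact .inl rfl⟩
  have h₁ : τ.face 0 1 = .edge (.inr h) := by
    rw [Cube.eq_edge (τ.face 0 1)]
    refine Subtype.ext (funext fun t => ?_)
    simp only [Cube.edge, Cube.face_one_two]
    rfl
  have h₂ : τ.face 1 0 = .edge (.inr h.symm) := by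
    rw [Cube.eq_edge (τ.face 1 0)]
    refine Subtype.ext (funext fun t => ?_)
    simp only [Cube.edge, Cube.face_zero_two]
    rfl
  have h₃ : (τ.face 1 1).toChain = 0 := by
    refine Cube.toChain_eq_zero (σ := τ.face 1 1) ?_
    rw [Cube.eq_edge (τ.face 1 1)]
    refine ⟨0, fun t a => ?_⟩
    simp only [Cube.edge, Cube.face_one_two]
    simp [τ]
  have h₄ : (τ.face 0 0).toChain = 0 := by
    refine Cube.toChain_eq_zero (σ := τ.face 0 0) ?_
    rw [Cube.eq_edge (τ.face 0 0)]
    refine ⟨0, fun t a => ?_⟩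
    simp only [Cube.edge, Cube.face_zero_two]
    simp [τ]
  refine ⟨τ.toChain, ?_⟩
  rw [cubicalBoundary_toChain, Cube.boundary_two, h₁, h₂, h₃, h₄, add_zero, sub_zero]

/-- The first cubical homology of a cycle of more than four points is infinite cyclic. -/
theorem cubicalHomology_cycleGraph_one (n : ℕ) :
    Nonempty (cubicalHomology (SimpleGraph.cycleGraph (n + 5)) 1 ≃+ ℤ) := by
  let G := SimpleGraph.cycleGraph (n + 5)
  have hadj : ∀ i, G.Adj i (i + 1) := fun i => cycleGraph_adj_iff.2 (.inl rfl)
  let κ : CubicalChain G 0 →ₗ[ℤ] (Fin (n + 5) → ℤ) :=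
    cubicalLift (fun σ => Pi.single (σ.1 0) 1) fun σ h => absurd h σ.not_isDegenerate_zero
  let w : CubicalChain G 1 →ₗ[ℤ] ℤ :=
    cubicalLift (fun σ => cycleStep (n := n + 1) (σ.1 fun _ => 0) (σ.1 fun _ => 1)) fun σ h => by
      obtain ⟨i, hi⟩ := h
      have h01 := hi (fun _ => 0) 1
      have hupd : Function.update (fun _ : Fin 1 => (0 : Fin 2)) i 1 = fun _ => 1 :=
        funext fun j => by rw [Subsingleton.elim j i, Function.update_self]
      rw [hupd] at h01
      rw [h01]
      exact cycleStep_self (n := n + 1) _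
  have hw : ∀ σ : Cube G 1, w σ.toChain =
      cycleStep (n := n + 1) (σ.1 fun _ => 0) (σ.1 fun _ => 1) := fun σ =>
    cubicalLift_toChain _ _ σ
  have hwd : w ∘ₗ cubicalBoundary G 1 = 0 := cubicalChain_hom_ext fun τ => by
    rw [LinearMap.comp_apply, cubicalBoundary_toChain, Cube.boundary_two, map_sub, map_add,
      map_add, hw, hw, hw, hw, LinearMap.zero_apply]
    simp only [Cube.face_zero_two, Cube.face_one_two]
    have h : ∀ s t : Fin 2 → Fin 2, (∃ i, s i ≠ t i ∧ ∀ j, j ≠ i → s j = t j) →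
        τ.1 s = τ.1 t ∨ G.Adj (τ.1 s) (τ.1 t) := fun s t h => τ.2 (unitCube_adj.2 h)
    have := cycleStep_sum_four (h ![0, 0] ![1, 0] (by decide)) (h ![1, 0] ![1, 1] (by decide))
      (h ![1, 1] ![0, 1] (by decide)) (h ![0, 1] ![0, 0] (by decide))
    rw [cycleStep_antisymm (τ.1 ![0, 1]) (τ.1 ![1, 1]),
      cycleStep_antisymm (τ.1 ![0, 0]) (τ.1 ![0, 1])] at this
    linarith
  refine nonempty_homology_one_of_winding (cubicalBoundary G)
    (fun q => ofHom_comp_ofHom_eq_zero (cubicalBoundary_comp G q))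
    (fun i => cubicalBoundary_edge (.inr (hadj i))) κ
    (fun i => cubicalLift_toChain _ _ (Cube.vertex G i))
    (fun y => LinearMap.congr_fun (cubicalBoundary_comp G 0) y) ?_ w
    (fun i => (hw _).trans (cycleStep_add_one (n := n + 1) i)) (LinearMap.congr_fun hwd)
  rw [← span_range_cube_toChain, Submodule.span_le]
  rintro _ ⟨σ, rfl⟩
  have hmem : ∀ i, (Cube.edge (.inr (hadj i))).toChain ∈
      Submodule.span ℤ (Set.range fun i => (Cube.edge (.inr (hadj i))).toChain) ⊔
        LinearMap.range (cubicalBoundary G 1) := fun i =>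
    Submodule.mem_sup_left (Submodule.subset_span ⟨i, rfl⟩)
  have key : ∀ (u v : Fin (n + 5)) (h : u = v ∨ G.Adj u v), (Cube.edge h).toChain ∈
      Submodule.span ℤ (Set.range fun i => (Cube.edge (.inr (hadj i))).toChain) ⊔
        LinearMap.range (cubicalBoundary G 1) := fun u v h => by
    rcases h with rfl | h
    · rw [Cube.toChain_eq_zero (Cube.isDegenerate_edge_self u)]
      exact zero_mem _
    · rcases cycleGraph_adj_iff.1 h with rfl | rfl
      · exact hmem u
      · have := sub_mem (Submodule.mem_sup_right (toChain_edge_add_symm_mem_range h)) (hmem v)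
        rwa [add_sub_cancel_right] at this
  rw [σ.eq_edge]
  exact key _ _ _

end Cubical

/-! ### Points and faces of elementary cubes -/

section ElementaryCubes

variable {n : ℕ}

/-- The vertex of an elementary cube with the given `0`-`1` coordinates. -/
noncomputable def ElementaryCube.point {q : ℕ} (Q : ElementaryCube n q) (t : Fin q → Fin 2) :
    Fin n → ℤ :=
  Q.corner + Function.extend Q.dirs (fun i => ((t i : ℕ) : ℤ)) 0

lemma ElementaryCube.point_dirs {q : ℕ} (Q : ElementaryCube n q) (t : Fin q → Fin 2) (i : Fin q) :
    Q.point t (Q.dirs i) = Q.corner (Q.dirs i) + ((t i : ℕ) : ℤ) := by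
  rw [point, Pi.add_apply, Q.dirs.injective.extend_apply]

lemma ElementaryCube.point_of_notMem {q : ℕ} (Q : ElementaryCube n q) (t : Fin q → Fin 2)
    {k : Fin n} (hk : k ∉ Set.range Q.dirs) : Q.point t k = Q.corner k := by
  rw [point, Pi.add_apply, Function.extend_apply' _ _ _ hk, Pi.zero_apply, add_zero]

lemma ElementaryCube.mem_toSet {q : ℕ} {Q : ElementaryCube n q} {x : Fin n → ℤ} :
    x ∈ Q.toSet ↔ ∀ k, x k = Q.corner k ∨ k ∈ Set.range Q.dirs ∧ x k = Q.corner k + 1 := by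
  simp only [toSet, Set.mem_pi, Set.mem_univ, true_implies, interval]
  refine forall_congr' fun k => ?_
  split_ifs with h <;> simp [h]

lemma ElementaryCube.point_mem_toSet {q : ℕ} (Q : ElementaryCube n q) (t : Fin q → Fin 2) :
    Q.point t ∈ Q.toSet := by
  rw [mem_toSet]
  intro k
  by_cases hk : k ∈ Set.range Q.dirs
  · obtain ⟨i, rfl⟩ := hk
    rw [point_dirs]
    have h : ∀ a : Fin 2, a = 0 ∨ a = 1 := by decide
    rcases h (t i) with h | h <;> simp [h]
  · exact .inl (Q.point_of_notMem t hk)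

lemma ElementaryCube.corner_le {q : ℕ} {Q : ElementaryCube n q} {x : Fin n → ℤ}
    (hx : x ∈ Q.toSet) : Q.corner ≤ x := fun k => by
  rcases mem_toSet.1 hx k with h | ⟨-, h⟩
  · exact h.ge
  · rw [h]; exact Int.le_add_one le_rfl

lemma ElementaryCube.point_injective {q : ℕ} (Q : ElementaryCube n q) :
    Function.Injective Q.point := fun s t h => funext fun i => by
  have := congrFun h (Q.dirs i)
  rw [point_dirs, point_dirs] at this
  omega

lemma ElementaryCube.point_adj {q : ℕ} (Q : ElementaryCube n q) {s t : Fin q → Fin 2}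
    (h : ∃ i, s i ≠ t i ∧ ∀ j, j ≠ i → s j = t j) :
    (latticeGraph n 1).Adj (Q.point s) (Q.point t) := by
  obtain ⟨i, hi, hij⟩ := h
  refine latticeGraph_one_adj.2 ⟨Q.dirs i, ?_, fun k hk => ?_⟩
  · rw [point_dirs, point_dirs, add_sub_add_left_eq_sub]
    have h : ∀ a b : Fin 2, a ≠ b → |((a : ℕ) : ℤ) - ((b : ℕ) : ℤ)| = 1 := by decide
    exact h _ _ hi
  · by_cases hr : k ∈ Set.range Q.dirs
    · obtain ⟨j, rfl⟩ := hr
      rw [point_dirs, point_dirs, hij j fun e => hk (congrArg _ e)]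
    · rw [point_of_notMem _ _ hr, point_of_notMem _ _ hr]

lemma ElementaryCube.point_zero {q : ℕ} (Q : ElementaryCube n q) :
    (Q.point fun _ => 0) = Q.corner :=
  funext fun k => by
    by_cases hr : k ∈ Set.range Q.dirs
    · obtain ⟨j, rfl⟩ := hr
      simp [point_dirs]
    · exact Q.point_of_notMem _ hr

variable {X : Set (Fin n → ℤ)}

/-- The vertices of an elementary cube of `X`, as points of `X`. -/
noncomputable def C1Cube.point {q : ℕ} (Q : C1Cube X q) (t : Fin q → Fin 2) : X :=
  ⟨Q.1.point t, Q.2 (Q.1.point_mem_toSet t)⟩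

lemma C1Cube.point_injective {q : ℕ} (Q : C1Cube X q) : Function.Injective Q.point :=
  fun _ _ h => Q.1.point_injective (congrArg Subtype.val h)

lemma C1Cube.point_adj {q : ℕ} (Q : C1Cube X q) {s t : Fin q → Fin 2}
    (h : ∃ i, s i ≠ t i ∧ ∀ j, j ≠ i → s j = t j) :
    ((latticeGraph n 1).induce X).Adj (Q.point s) (Q.point t) :=
  Q.1.point_adj h

lemma C1Cube.point_zero_lt_one (Q : C1Cube X 1) :
    (Q.point fun _ => 0) < Q.point fun _ => 1 := by
  refine lt_of_le_of_ne ?_ fun e => absurd (congrFun (Q.point_injective e) 0) (by decide)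
  change (Q.1.point fun _ => 0) ≤ Q.1.point fun _ => 1
  rw [ElementaryCube.point_zero]
  exact ElementaryCube.corner_le (Q.1.point_mem_toSet _)

/-- A `1`-cube is determined by its two endpoints. -/
lemma C1Cube.ext_point {Q Q' : C1Cube X 1} (h₀ : (Q.point fun _ => 0) = Q'.point fun _ => 0)
    (h₁ : (Q.point fun _ => 1) = Q'.point fun _ => 1) : Q = Q' := by
  replace h₀ : Q.1.corner = Q'.1.corner := by
    rw [← ElementaryCube.point_zero, ← ElementaryCube.point_zero]
    exact congrArg Subtype.val h₀
  refine Subtype.ext (ElementaryCube.ext h₀ (RelEmbedding.ext fun i => ?_))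
  rw [Subsingleton.elim i 0]
  by_contra hne
  have h := congrFun (congrArg Subtype.val h₁) (Q.1.dirs 0)
  change Q.1.point _ _ = Q'.1.point _ _ at h
  rw [ElementaryCube.point_dirs, ElementaryCube.point_of_notMem, h₀] at h
  · simp at h
  · rintro ⟨j, hj⟩
    rw [Subsingleton.elim j 0] at hj
    exact hne hj.symm

/-- The `0`-cube at a point. -/
def C1Cube.vertex (x : X) : C1Cube X 0 :=
  ⟨⟨x.1, OrderEmbedding.ofIsEmpty⟩, fun y hy => by
    have : y = x.1 := funext fun k => by
      rcases ElementaryCube.mem_toSet.1 hy k with h | ⟨⟨i, _⟩, _⟩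
      · exact h
      · exact i.elim0
    rw [this]
    exact x.2⟩

lemma C1Cube.vertex_injective : Function.Injective (vertex (X := X)) := fun _ _ h =>
  Subtype.ext (congrArg (fun Q : C1Cube X 0 => Q.1.corner) h)

lemma C1Cube.eq_vertex (P : C1Cube X 0) : P = vertex (P.point fun _ => 0) :=
  Subtype.ext (ElementaryCube.ext P.1.point_zero.symm (RelEmbedding.ext fun i => i.elim0))

lemma C1Cube.point_vertex (x : X) (t) : (vertex x).point t = x :=
  vertex_injective (by
    conv_rhs => rw [eq_vertex (vertex x)]
    rw [Subsingleton.elim t fun _ => 0])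

lemma C1Cube.face_one (Q : C1Cube X 1) (ε : Fin 2) : Q.face ε 0 = vertex (Q.point fun _ => ε) := by
  refine Subtype.ext (ElementaryCube.ext (funext fun k => ?_) (RelEmbedding.ext fun i => i.elim0))
  change Function.update Q.1.corner (Q.1.dirs 0) (Q.1.corner (Q.1.dirs 0) + ((ε : ℕ) : ℤ)) k =
    Q.1.point (fun _ => ε) k
  rcases eq_or_ne k (Q.1.dirs 0) with rfl | hk
  · rw [Function.update_self, ElementaryCube.point_dirs]
  · rw [Function.update_of_ne hk, ElementaryCube.point_of_notMem]
    rintro ⟨i, rfl⟩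
    exact hk (by rw [Subsingleton.elim i 0])

lemma c1Boundary_single {q : ℕ} (Q : C1Cube X (q + 1)) :
    c1Boundary X q (Finsupp.single Q 1) = Q.boundary :=
  linearCombination_single_one _ Q

lemma C1Cube.boundary_one (Q : C1Cube X 1) :
    Q.boundary = Finsupp.single (vertex (Q.point fun _ => 1)) 1 -
      Finsupp.single (vertex (Q.point fun _ => 0)) 1 := by
  rw [C1Cube.boundary, Fin.sum_univ_one, face_one, face_one]
  simp

/-- Two adjacent points are the endpoints of a `1`-cube. -/
lemma exists_c1Cube_of_adj {x y : X} (h : ((latticeGraph n 1).induce X).Adj x y) :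
    ∃ Q : C1Cube X 1, (Q.point fun _ => 0) = x ∧ (Q.point fun _ => 1) = y ∨
      (Q.point fun _ => 0) = y ∧ (Q.point fun _ => 1) = x := by
  have key : ∀ (x y : X) (i : Fin n), y.1 i - x.1 i = 1 → (∀ j, j ≠ i → x.1 j = y.1 j) →
      ∃ Q : C1Cube X 1, (Q.point fun _ => 0) = x ∧ (Q.point fun _ => 1) = y := by
    intro x y i hi hij
    let E : ElementaryCube n 1 :=
      ⟨x.1, OrderEmbedding.ofStrictMono (fun _ => i) (Subsingleton.strictMono _)⟩
    have hr : ∀ k, k ∈ Set.range E.dirs ↔ k = i := fun k =>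
      ⟨fun ⟨_, h⟩ => h.symm, fun h => ⟨0, h.symm⟩⟩
    have hE : E.toSet ⊆ X := fun z hz => by
      have hz := ElementaryCube.mem_toSet.1 hz
      simp only [hr] at hz
      rcases hz i with hzi | hzi
      · have : z = x.1 := funext fun k => (hz k).elim id fun h => by rw [h.1, hzi]
        rw [this]
        exact x.2
      · have : z = y.1 := funext fun k => by
          rcases eq_or_ne k i with rfl | hk
          · rw [hzi.2]
            change x.1 k + 1 = y.1 k
            omega
          · rw [← hij k hk]
            exact (hz k).elim id fun h => absurd h.1 hk
        rw [this]
        exact y.2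
    refine ⟨⟨E, hE⟩, Subtype.ext E.point_zero, Subtype.ext (funext fun k => ?_)⟩
    change E.point (fun _ => 1) k = y.1 k
    rcases eq_or_ne k i with rfl | hk
    · have := E.point_dirs (fun _ => 1) 0
      change E.point (fun _ => 1) k = x.1 k + 1 at this
      omega
    · rw [E.point_of_notMem _ (by rw [hr]; exact hk)]
      exact hij k hk
  obtain ⟨i, hi, hij⟩ := latticeGraph_one_adj.1 h
  rcases (abs_eq zero_le_one).1 hi with hi | hi
  · obtain ⟨Q, h₀, h₁⟩ := key y x i hi fun j hj => (hij j hj).symm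
    exact ⟨Q, .inr ⟨h₀, h₁⟩⟩
  · obtain ⟨Q, h₀, h₁⟩ := key x y i (by rw [← neg_sub]; exact neg_eq_iff_eq_neg.2 hi) hij
    exact ⟨Q, .inl ⟨h₀, h₁⟩⟩

lemma top_le_of_forall_single_mem {α : Type*} {S : Submodule ℤ (α →₀ ℤ)}
    (h : ∀ a, Finsupp.single a 1 ∈ S) : ⊤ ≤ S := fun z _ => by
  induction z using Finsupp.induction_linear with
  | zero => exact zero_mem S
  | add f g hf hg => exact add_mem (hf trivial) (hg trivial)
  | single a k => simpa using S.smul_mem k (h a)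

variable (X) in
/-- An embedded connected image has infinite cyclic `c_1`-cubical homology in degree `0`. -/
theorem c1Homology_zero (hX : ((latticeGraph n 1).induce X).Connected) :
    Nonempty (c1Homology X 0 ≃+ ℤ) := by
  let ε : C1Chain X 0 →ₗ[ℤ] ℤ := Finsupp.linearCombination ℤ fun _ => 1
  have hε : ∀ P, ε (Finsupp.single P 1) = 1 := fun P => linearCombination_single_one _ P
  have hεd : ε ∘ₗ c1Boundary X 0 = 0 :=
    Finsupp.lhom_ext' fun Q => LinearMap.ext_ring <| by
      change ε (c1Boundary X 0 (Finsupp.single Q 1)) = 0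
      rw [c1Boundary_single, C1Cube.boundary_one, map_sub, hε, hε, sub_self]
  refine nonempty_homology_zero_of_connected (c1Boundary X)
    (fun q => ofHom_comp_ofHom_eq_zero (c1Boundary_comp X q)) hX
    (fun x => Finsupp.single (C1Cube.vertex x) 1) ?_ ε
    (fun v => hε _) (LinearMap.congr_fun hεd) fun u v h => ?_
  · refine top_le_of_forall_single_mem fun P => Submodule.subset_span ⟨P.point fun _ => 0, ?_⟩
    exact congrArg (Finsupp.single · 1) P.eq_vertex.symm
  · obtain ⟨Q, ⟨rfl, rfl⟩ | ⟨rfl, rfl⟩⟩ := exists_c1Cube_of_adj h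
    · exact ⟨Finsupp.single Q 1, by rw [c1Boundary_single, C1Cube.boundary_one]⟩
    · exact ⟨-Finsupp.single Q 1, by
        rw [map_neg, c1Boundary_single, C1Cube.boundary_one, neg_sub]⟩

end ElementaryCubes

section EmbeddedCycles

variable {n : ℕ} {X : Set (Fin n → ℤ)}

/-! ### Embedded cycles contain few elementary cubes -/

lemma IsEmbeddedCycle.connected {m : ℕ} (h : IsEmbeddedCycle X (m + 1)) :
    ((latticeGraph n 1).induce X).Connected :=
  (h.some.connected_iff).1 SimpleGraph.cycleGraph_connected

/-- The edges of a cube at its least vertex bound its dimension by the degree of that vertex. -/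
lemma C1Cube.dim_le_degree {m q : ℕ}
    (φ : SimpleGraph.cycleGraph m ≃g (latticeGraph n 1).induce X) (Q : C1Cube X q) :
    q ≤ (SimpleGraph.cycleGraph m).degree (φ.symm (Q.point fun _ => 0)) := by
  rw [← SimpleGraph.card_neighborFinset_eq_degree]
  refine (Finset.card_fin q).symm.trans_le ?_
  refine Finset.card_le_card_of_injOn (fun i => φ.symm (Q.point (Pi.single i 1))) (fun i _ => ?_)
    fun i _ j _ hij => ?_
  · rw [Finset.mem_coe, SimpleGraph.mem_neighborFinset, φ.symm.map_adj_iff]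
    refine Q.point_adj ⟨i, by simp, fun j hj => by simp [hj]⟩
  · have := congrFun (Q.point_injective (φ.symm.injective hij)) i
    by_contra hne
    simp [hne] at this

lemma isEmpty_c1Cube_of_two (h : IsEmbeddedCycle X 2) (q : ℕ) : IsEmpty (C1Cube X (q + 2)) := by
  refine ⟨fun Q => ?_⟩
  have h₁ := Q.dim_le_degree h.some
  have h₂ := (SimpleGraph.cycleGraph 2).degree_lt_card_verts (h.some.symm (Q.point fun _ => 0))
  rw [Fintype.card_fin] at h₂
  omega

lemma isEmpty_c1Cube_add_three {m : ℕ} (h : IsEmbeddedCycle X (m + 2)) (q : ℕ) :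
    IsEmpty (C1Cube X (q + 3)) := by
  refine ⟨fun Q => ?_⟩
  have h₁ := Q.dim_le_degree h.some
  rw [SimpleGraph.cycleGraph_degree_two_le] at h₁
  have := h₁.trans Finset.card_le_two
  omega

/-- An embedded cycle of more than four points contains no elementary square, as the boundary of
one would be a four-cycle. -/
lemma isEmpty_c1Cube_add_two {m : ℕ} (h : IsEmbeddedCycle X (m + 5)) (q : ℕ) :
    IsEmpty (C1Cube X (q + 2)) := by
  induction q with
  | succ q ih => exact ⟨fun Q => ih.false (Q.face 0 0)⟩
  | zero =>
    obtain ⟨φ⟩ := h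
    refine ⟨fun Q => ?_⟩
    have hadj : ∀ s t : Fin 2 → Fin 2, (∃ i, s i ≠ t i ∧ ∀ j, j ≠ i → s j = t j) →
        (SimpleGraph.cycleGraph (m + 5)).Adj (φ.symm (Q.point s)) (φ.symm (Q.point t)) :=
      fun s t h => φ.symm.map_adj_iff.2 (Q.point_adj h)
    have hne : ∀ s t : Fin 2 → Fin 2, s ≠ t → φ.symm (Q.point s) ≠ φ.symm (Q.point t) :=
      fun s t h e => h (Q.point_injective (φ.symm.injective e))
    exact cycleGraph_no_square (hne ![0, 0] ![1, 1] (by decide))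
      (hne ![1, 0] ![0, 1] (by decide)) (hadj _ _ (by decide)) (hadj _ _ (by decide))
      (hadj _ _ (by decide)) (hadj _ _ (by decide))

lemma c1Homology_succ_of_isEmpty (q : ℕ) (h : IsEmpty (C1Cube X (q + 1))) :
    Subsingleton (c1Homology X (q + 1)) :=
  subsingleton_homology_complexOf (c1Boundary X)
    (fun q => ofHom_comp_ofHom_eq_zero (c1Boundary_comp X q)) q fun _ _ =>
      ⟨0, Subsingleton.elim _ _⟩

/-- An embedded cycle of two points has a single `1`-cube, and its boundary is not zero. -/
theorem c1Homology_one_of_two (h : IsEmbeddedCycle X 2) : Subsingleton (c1Homology X 1) := by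
  have hsub : Subsingleton (C1Cube X 1) := ⟨fun Q Q' => by
    obtain ⟨φ⟩ := h
    have hQ := Q.point_zero_lt_one
    have hQ' := Q'.point_zero_lt_one
    have h2 : ∀ a b c d : Fin 2, a ≠ b → c ≠ d → a = c ∧ b = d ∨ a = d ∧ b = c := by decide
    rcases h2 _ _ _ _ (φ.symm.injective.ne hQ.ne) (φ.symm.injective.ne hQ'.ne) with h | h
    · exact C1Cube.ext_point (φ.symm.injective h.1) (φ.symm.injective h.2)
    · rw [φ.symm.injective h.1, φ.symm.injective h.2] at hQ
      exact absurd hQ hQ'.asymm⟩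
  refine subsingleton_homology_complexOf (c1Boundary X)
    (fun q => ofHom_comp_ofHom_eq_zero (c1Boundary_comp X q)) 0 fun z hz => ⟨0, ?_⟩
  rw [map_zero]
  refine Finsupp.ext fun Q => ?_
  have hzQ : z = z Q • Finsupp.single Q 1 := Finsupp.ext fun Q' => by
    rw [Subsingleton.elim Q' Q]; simp
  rw [hzQ, map_zsmul, c1Boundary_single, C1Cube.boundary_one] at hz
  have hne : C1Cube.vertex (Q.point fun _ => 0) ≠ C1Cube.vertex (Q.point fun _ => 1) :=
    C1Cube.vertex_injective.ne Q.point_zero_lt_one.ne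
  have := DFunLike.congr_fun hz (C1Cube.vertex (Q.point fun _ => 1))
  simpa [Finsupp.single_eq_of_ne hne.symm] using this.symm

/-! ### The edges of an embedded cycle -/

/-- The coordinates of a `0`-chain of an embedded cycle: a point of `X` goes to the unit vector of
its position on the cycle. -/
noncomputable def cyclePosition {m : ℕ}
    (φ : SimpleGraph.cycleGraph m ≃g (latticeGraph n 1).induce X) :
    C1Chain X 0 →ₗ[ℤ] (Fin m → ℤ) :=
  Finsupp.linearCombination ℤ fun P => Pi.single (φ.symm (P.point fun _ => 0)) 1

lemma cyclePosition_vertex {m : ℕ}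
    (φ : SimpleGraph.cycleGraph m ≃g (latticeGraph n 1).induce X) (i : Fin m) :
    cyclePosition φ (Finsupp.single (C1Cube.vertex (φ i)) 1) = Pi.single i 1 := by
  rw [cyclePosition, linearCombination_single_one, C1Cube.point_vertex, φ.symm_apply_apply]

/-- The signed number of steps around the cycle made by a `1`-chain. -/
noncomputable def cycleWinding {m : ℕ}
    (φ : SimpleGraph.cycleGraph (m + 4) ≃g (latticeGraph n 1).induce X) :
    C1Chain X 1 →ₗ[ℤ] ℤ :=
  Finsupp.linearCombination ℤ fun Q =>
    cycleStep (φ.symm (Q.point fun _ => 0)) (φ.symm (Q.point fun _ => 1))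

/-- The `1`-cubes of an embedded cycle, oriented along the cycle, span the `1`-chains. -/
lemma exists_c1_edges {m : ℕ}
    (φ : SimpleGraph.cycleGraph (m + 4) ≃g (latticeGraph n 1).induce X) :
    ∃ e : Fin (m + 4) → C1Chain X 1,
      (∀ i, c1Boundary X 0 (e i) = Finsupp.single (C1Cube.vertex (φ (i + 1))) 1 -
        Finsupp.single (C1Cube.vertex (φ i)) 1) ∧
      (∀ i, cycleWinding φ (e i) = 1) ∧ ⊤ ≤ Submodule.span ℤ (Set.range e) := by
  have hadj : ∀ i, ((latticeGraph n 1).induce X).Adj (φ i) (φ (i + 1)) := fun i =>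
    φ.map_adj_iff.2 (cycleGraph_adj_iff.2 (.inl rfl))
  have hw : ∀ Q, cycleWinding φ (Finsupp.single Q 1) =
      cycleStep (φ.symm (Q.point fun _ => 0)) (φ.symm (Q.point fun _ => 1)) := fun Q =>
    linearCombination_single_one _ Q
  choose Q hQ using fun i => exists_c1Cube_of_adj (hadj i)
  have key : ∀ i, ∃ e : C1Chain X 1, c1Boundary X 0 e =
      Finsupp.single (C1Cube.vertex (φ (i + 1))) 1 - Finsupp.single (C1Cube.vertex (φ i)) 1 ∧
      cycleWinding φ e = 1 ∧ Finsupp.single (Q i) 1 ∈ Submodule.span ℤ {e} := fun i => by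
    rcases hQ i with ⟨h₀, h₁⟩ | ⟨h₀, h₁⟩
    · refine ⟨Finsupp.single (Q i) 1, ?_, ?_, Submodule.mem_span_singleton_self _⟩
      · rw [c1Boundary_single, C1Cube.boundary_one, h₀, h₁]
      · rw [hw, h₀, h₁, φ.symm_apply_apply, φ.symm_apply_apply, cycleStep_add_one]
    · refine ⟨-Finsupp.single (Q i) 1, ?_, ?_,
        neg_mem_iff.1 (Submodule.mem_span_singleton_self _)⟩
      · rw [map_neg, c1Boundary_single, C1Cube.boundary_one, h₀, h₁, neg_sub]
      · rw [map_neg, hw, h₀, h₁, φ.symm_apply_apply, φ.symm_apply_apply, cycleStep_antisymm,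
          cycleStep_add_one, neg_neg]
  choose e he hwe hspan using key
  refine ⟨e, he, hwe, top_le_of_forall_single_mem fun P => ?_⟩
  have hmem : ∀ i, Finsupp.single (Q i) 1 ∈ Submodule.span ℤ (Set.range e) := fun i =>
    Submodule.span_mono (Set.singleton_subset_iff.2 (Set.mem_range_self i)) (hspan i)
  -- A `1`-cube with the endpoints of `Q i` is `Q i`, the order of the endpoints being prescribed.
  have huniq : ∀ i, (P.point fun _ => 0) = φ i ∧ (P.point fun _ => 1) = φ (i + 1) ∨
      (P.point fun _ => 0) = φ (i + 1) ∧ (P.point fun _ => 1) = φ i → P = Q i := fun i hP => by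
    have h₁ := P.point_zero_lt_one
    have h₂ := (Q i).point_zero_lt_one
    rcases hP with ⟨p₀, p₁⟩ | ⟨p₀, p₁⟩ <;> rcases hQ i with ⟨q₀, q₁⟩ | ⟨q₀, q₁⟩
    · exact C1Cube.ext_point (p₀.trans q₀.symm) (p₁.trans q₁.symm)
    · rw [p₀, p₁] at h₁
      rw [q₀, q₁] at h₂
      exact absurd h₁ h₂.asymm
    · rw [p₀, p₁] at h₁
      rw [q₀, q₁] at h₂
      exact absurd h₁ h₂.asymm
    · exact C1Cube.ext_point (p₀.trans q₀.symm) (p₁.trans q₁.symm)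
  have hP : ((latticeGraph n 1).induce X).Adj (P.point fun _ => 0) (P.point fun _ => 1) :=
    P.point_adj ⟨0, by simp, fun j hj => absurd (Subsingleton.elim _ _) hj⟩
  rcases cycleGraph_adj_iff.1 (φ.symm.map_adj_iff.2 hP) with h | h
  · rw [huniq (φ.symm (P.point fun _ => 0)) (.inl ⟨by simp, by rw [← h]; simp⟩)]
    exact hmem _
  · rw [huniq (φ.symm (P.point fun _ => 1)) (.inr ⟨by rw [← h]; simp, by simp⟩)]
    exact hmem _

/-- An embedded cycle of more than four points has infinite cyclic first `c_1`-cubical homology. -/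
theorem c1Homology_one_of_five_le {m : ℕ} (h : IsEmbeddedCycle X (m + 5)) :
    Nonempty (c1Homology X 1 ≃+ ℤ) := by
  have := isEmpty_c1Cube_add_two h 0
  obtain ⟨φ⟩ := h
  obtain ⟨e, he, hwe, hspan⟩ := exists_c1_edges (m := m + 1) φ
  exact nonempty_homology_one_of_winding (m := m + 5) (c1Boundary X)
    (fun q => ofHom_comp_ofHom_eq_zero (c1Boundary_comp X q))
    (x := fun i => Finsupp.single (C1Cube.vertex (φ i)) 1) he (cyclePosition φ)
    (cyclePosition_vertex φ) (fun y => LinearMap.congr_fun (c1Boundary_comp X 0) y)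
    (le_trans hspan le_sup_left) (cycleWinding (m := m + 1) φ) hwe
    fun y => by rw [Subsingleton.elim y 0, map_zero, map_zero]

/-! ### Embedded cycles of four points -/

/-- In the boundary of an elementary square, the first of its faces occurs once. -/
lemma C1Cube.boundary_two_apply (Q : C1Cube X 2) : Q.boundary (Q.face 0 0) = -1 := by
  have hdirs : ∀ ε, Q.face ε 1 ≠ Q.face 0 0 := fun ε h => by
    have h : Q.1.dirs 0 = Q.1.dirs 1 :=
      DFunLike.congr_fun (congrArg (fun P : C1Cube X 1 => P.1.dirs) h) 0
    exact absurd (Q.1.dirs.injective h) (by decide)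
  have hcorner : Q.face 1 0 ≠ Q.face 0 0 := fun h => by
    have := congrFun (congrArg (fun P : C1Cube X 1 => P.1.corner) h) (Q.1.dirs 0)
    simp [C1Cube.face, ElementaryCube.face] at this
  rw [C1Cube.boundary, Fin.sum_univ_two]
  simp [hdirs, hcorner]

/-- The second `c_1`-cubical homology of an embedded cycle of four points vanishes: the vertices of
an elementary square are all the points of the cycle, so there is at most one square, and its
boundary is not zero. -/
theorem c1Homology_two_of_four (h : IsEmbeddedCycle X 4) : Subsingleton (c1Homology X 2) := by
  obtain ⟨φ⟩ := h
  have hsurj : ∀ Q : C1Cube X 2, Function.Surjective Q.point := fun Q => by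
    have hcard : Fintype.card (Fin 2 → Fin 2) = Fintype.card (Fin 4) := by decide
    have := (Fintype.bijective_iff_injective_and_card (fun t => φ.symm (Q.point t))).2
      ⟨φ.symm.injective.comp Q.point_injective, hcard⟩
    intro x
    obtain ⟨t, ht⟩ := this.2 (φ.symm x)
    exact ⟨t, φ.symm.injective ht⟩
  have hsub : Subsingleton (C1Cube X 2) := ⟨fun Q Q' => by
    have hle : ∀ Q Q' : C1Cube X 2, Q.1.corner ≤ Q'.1.corner := fun Q Q' => by
      obtain ⟨t, ht⟩ := hsurj Q (Q'.point fun _ => 0)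
      rw [← Q'.1.point_zero]
      exact (ElementaryCube.corner_le (Q.1.point_mem_toSet t)).trans_eq (congrArg Subtype.val ht)
    have hc := le_antisymm (hle Q Q') (hle Q' Q)
    have hr : ∀ Q Q' : C1Cube X 2, Q.1.corner = Q'.1.corner →
        Set.range Q.1.dirs ⊆ Set.range Q'.1.dirs := by
      rintro Q Q' hc _ ⟨i, rfl⟩
      by_contra hi
      obtain ⟨t, ht⟩ := hsurj Q' (Q.point fun _ => 1)
      have ht := congrFun (congrArg Subtype.val ht) (Q.1.dirs i)
      change Q'.1.point _ _ = Q.1.point _ _ at ht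
      rw [ElementaryCube.point_of_notMem _ _ hi, ElementaryCube.point_dirs, hc] at ht
      simp at ht
    exact Subtype.ext (ElementaryCube.ext hc
      (OrderEmbedding.range_inj.1 ((hr Q Q' hc).antisymm (hr Q' Q hc.symm))))⟩
  refine subsingleton_homology_complexOf (c1Boundary X)
    (fun q => ofHom_comp_ofHom_eq_zero (c1Boundary_comp X q)) 1 fun z hz => ⟨0, ?_⟩
  rw [map_zero]
  refine Finsupp.ext fun Q => ?_
  have hzQ : z = z Q • Finsupp.single Q 1 := Finsupp.ext fun Q' => by
    rw [Subsingleton.elim Q' Q]; simp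
  rw [hzQ, map_zsmul, c1Boundary_single] at hz
  have := DFunLike.congr_fun hz (Q.face 0 0)
  simpa [Q.boundary_two_apply, eq_comm] using this

lemma latticeGraph_adj_iff_exists_single {x y : Fin n → ℤ} :
    (latticeGraph n 1).Adj x y ↔ ∃ i s, (s = 1 ∨ s = -1) ∧ y = x + Pi.single i s := by
  rw [latticeGraph_one_adj]
  constructor
  · rintro ⟨i, hi, hij⟩
    refine ⟨i, y i - x i, ?_, funext fun k => ?_⟩
    · rcases (abs_eq zero_le_one).1 hi with h | h <;> omega
    · rcases eq_or_ne k i with rfl | hk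
      · simp
      · simp [hk, hij k hk]
  · rintro ⟨i, s, hs, rfl⟩
    refine ⟨i, ?_, fun j hj => by simp [hj]⟩
    rcases hs with rfl | rfl <;> simp

/-- A four-cycle of the lattice spans an elementary square. -/
lemma exists_square {p₀ p₁ p₂ p₃ : Fin n → ℤ} (h₀₂ : p₀ ≠ p₂) (h₁₃ : p₁ ≠ p₃)
    (h₀₁ : (latticeGraph n 1).Adj p₀ p₁) (h₁₂ : (latticeGraph n 1).Adj p₁ p₂)
    (h₀₃ : (latticeGraph n 1).Adj p₀ p₃) (h₃₂ : (latticeGraph n 1).Adj p₃ p₂) :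
    ∃ Q : ElementaryCube n 2, Q.toSet ⊆ {p₀, p₁, p₂, p₃} := by
  obtain ⟨a, s, hs, rfl⟩ := latticeGraph_adj_iff_exists_single.1 h₀₁
  obtain ⟨b, t, ht, rfl⟩ := latticeGraph_adj_iff_exists_single.1 h₀₃
  obtain ⟨c, u, hu, rfl⟩ := latticeGraph_adj_iff_exists_single.1 h₁₂
  obtain ⟨d, v, hv, he⟩ := latticeGraph_adj_iff_exists_single.1 h₃₂
  have hk : ∀ k, (Pi.single a s : Fin n → ℤ) k + (Pi.single c u : Fin n → ℤ) k =
      (Pi.single b t : Fin n → ℤ) k + (Pi.single d v : Fin n → ℤ) k := fun k => by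
    have := congrFun he k
    simp only [Pi.add_apply] at this
    omega
  simp only [Pi.single_apply] at hk
  have hback : ¬ (c = a ∧ u = -s) := by
    rintro ⟨rfl, rfl⟩
    exact h₀₂ (by rw [add_assoc, ← Pi.single_add]; simp)
  have hsame : ¬ (a = b ∧ s = t) := by
    rintro ⟨rfl, rfl⟩
    exact h₁₃ rfl
  -- If `p₁` and `p₃` lay on one line through `p₀`, then `p₀` would be their only common neighbor.
  have hab : a ≠ b := by
    rintro rfl
    have h1 := hk a
    have h2 : t = -s := by omega
    subst h2
    rw [if_pos rfl, if_pos rfl] at h1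
    have hu' : a = c → u ≠ -s := fun e h => hback ⟨e.symm, h⟩
    split_ifs at h1 <;> omega
  -- The step from `p₁` to `p₂` is then the one from `p₀` to `p₃`, as it does not lead back to `p₀`.
  have hcb : c = b ∧ u = t := by
    have h1 := hk a
    have h2 := hk b
    have hba : ¬ b = a := fun e => hab e.symm
    by_cases hca : c = a
    · subst hca
      rw [if_pos rfl, if_pos rfl, if_neg hab] at h1
      rw [if_neg hba, if_neg hba, if_pos rfl] at h2
      exfalso
      apply hback
      refine ⟨rfl, ?_⟩
      split_ifs at h1 h2 <;> omega
    · have hac : ¬ a = c := fun e => hca e.symm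
      rw [if_pos rfl, if_neg hac, if_neg hab] at h1
      have had : a = d := by
        by_contra h
        rw [if_neg h] at h1
        omega
      subst had
      rw [if_neg hba, if_pos rfl] at h2
      by_cases hbc : b = c
      · rw [if_pos hbc] at h2
        exact ⟨hbc.symm, by omega⟩
      · rw [if_neg hbc] at h2
        omega
  obtain ⟨rfl, rfl⟩ := hcb
  obtain ⟨p, hp⟩ : ∃ p : Fin n → ℤ, p = p₀ + Pi.single a s + Pi.single c u := ⟨_, rfl⟩
  have hpa : p a = p₀ a + s := by simp [hp, hab]
  have hpc : p c = p₀ c + u := by simp [hp, hab.symm]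
  have hpne : ∀ k, k ≠ a → k ≠ c → p k = p₀ k := fun k ha hc => by simp [hp, ha, hc]
  let Q : ElementaryCube n 2 :=
    ⟨fun k => min (p₀ k) (p k), ({a, c} : Finset (Fin n)).orderEmbOfFin (Finset.card_pair hab)⟩
  refine ⟨Q, fun x hx => ?_⟩
  replace hx : ∀ k, x k = min (p₀ k) (p k) ∨ (k = a ∨ k = c) ∧ x k = min (p₀ k) (p k) + 1 :=
    fun k => by
      have := ElementaryCube.mem_toSet.1 hx k
      simpa [Q, Finset.range_orderEmbOfFin] using this
  have hne : ∀ k, k ≠ a → k ≠ c → x k = p₀ k := fun k ha hc => by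
    simpa [ha, hc, hpne k ha hc] using hx k
  have hxa : x a = p₀ a ∨ x a = p₀ a + s := by
    have := hx a
    rw [hpa] at this
    omega
  have hxc : x c = p₀ c ∨ x c = p₀ c + u := by
    have := hx c
    rw [hpc] at this
    omega
  have hext : ∀ y : Fin n → ℤ, x a = y a → x c = y c → (∀ k, k ≠ a → k ≠ c → y k = p₀ k) →
      x = y := fun y ha hc h => funext fun k => by
    rcases eq_or_ne k a with rfl | hka
    · exact ha
    rcases eq_or_ne k c with rfl | hkc
    · exact hc
    rw [hne k hka hkc, h k hka hkc]
  rcases hxa with ha | ha <;> rcases hxc with hc | hc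
  · exact .inl (hext _ ha hc fun _ _ _ => rfl)
  · refine .inr (.inr (.inr (hext _ ?_ ?_ fun k h h' => ?_))) <;> simp [*]
  · refine .inr (.inl (hext _ ?_ ?_ fun k h h' => ?_)) <;> simp [*, hab.symm]
  · refine .inr (.inr (.inl (hext _ ?_ ?_ fun k h h' => ?_))) <;> simp [*, hab.symm]

/-- The first `c_1`-cubical homology of an embedded cycle of four points vanishes. The cycle is
the set of vertices of a square, whose boundary is a multiple of the sum of the edges by an integer
that has to be a unit, as one of its coefficients is `-1`. -/
theorem c1Homology_one_of_four (h : IsEmbeddedCycle X 4) : Subsingleton (c1Homology X 1) := by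
  obtain ⟨φ⟩ := h
  obtain ⟨e, he, -, hspan⟩ := exists_c1_edges (m := 0) φ
  have hdd : ∀ y, c1Boundary X 0 (c1Boundary X 1 y) = 0 := fun y =>
    LinearMap.congr_fun (c1Boundary_comp X 0) y
  have hcyc : ∀ z, c1Boundary X 0 z = 0 → ∃ k : ℤ, z = k • ∑ i, e i := fun z hz => by
    obtain ⟨k, hk⟩ := exists_sub_zsmul_sum_edges_mem (c1Boundary X)
      (x := fun i => Finsupp.single (C1Cube.vertex (φ i)) 1) he (cyclePosition φ)
      (cyclePosition_vertex φ) ⊥ (fun b hb => by rw [(Submodule.mem_bot ℤ).1 hb, map_zero])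
      (hspan.trans le_sup_left) z hz
    exact ⟨k, sub_eq_zero.1 ((Submodule.mem_bot ℤ).1 hk)⟩
  have hadj : ∀ i j : Fin 4, (SimpleGraph.cycleGraph 4).Adj i j →
      (latticeGraph n 1).Adj (φ i).1 (φ j).1 := fun i j h => φ.map_adj_iff.2 h
  have hne : ∀ i j : Fin 4, i ≠ j → (φ i).1 ≠ (φ j).1 := fun i j h e =>
    h (φ.injective (Subtype.ext e))
  obtain ⟨E, hE⟩ := exists_square (hne 0 2 (by decide)) (hne 1 3 (by decide))
    (hadj 0 1 (by decide)) (hadj 1 2 (by decide)) (hadj 0 3 (by decide)) (hadj 3 2 (by decide))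
  let Q : C1Cube X 2 := ⟨E, hE.trans (by
    rintro _ (rfl | rfl | rfl | rfl)
    exacts [(φ 0).2, (φ 1).2, (φ 2).2, (φ 3).2])⟩
  obtain ⟨l, hl⟩ := hcyc _ (hdd (Finsupp.single Q 1))
  have hunit : l * l = 1 := by
    have := DFunLike.congr_fun hl (Q.face 0 0)
    rw [c1Boundary_single, Q.boundary_two_apply, Finsupp.smul_apply, smul_eq_mul] at this
    rcases Int.isUnit_iff.1 (IsUnit.of_mul_eq_one (-(∑ i, e i) (Q.face 0 0))
      (by linarith : l * (-(∑ i, e i) (Q.face 0 0)) = 1)) with h | h <;> rw [h] <;> norm_num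
  refine subsingleton_homology_complexOf (c1Boundary X)
    (fun q => ofHom_comp_ofHom_eq_zero (c1Boundary_comp X q)) 0 fun z hz => ?_
  obtain ⟨k, rfl⟩ := hcyc z hz
  exact ⟨(k * l) • Finsupp.single Q 1, by
    rw [map_zsmul, hl, smul_smul, mul_assoc, hunit, mul_one]⟩

end EmbeddedCycles

/-! ### Homology of cycles -/

lemma cycleGraph_adj_zero {m : ℕ} (hm : m + 1 < 4) (w : Fin (m + 1)) (hw : w ≠ 0) :
    (SimpleGraph.cycleGraph (m + 1)).Adj 0 w := by
  obtain rfl | rfl | rfl : m = 0 ∨ m = 1 ∨ m = 2 := by omega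
  all_goals revert w; decide

end DigitalHomology

theorem theorem9p2 :
    (∀ m : ℕ, 1 ≤ m → m < 4 →
      (Nonempty (DigitalHomology.simplicialHomology (SimpleGraph.cycleGraph m) 0 ≃+ ℤ) ∧
        ∀ q : ℕ, 0 < q →
          Subsingleton (DigitalHomology.simplicialHomology (SimpleGraph.cycleGraph m) q)) ∧
      (Nonempty (DigitalHomology.cubicalHomology (SimpleGraph.cycleGraph m) 0 ≃+ ℤ) ∧
        ∀ q : ℕ, 0 < q →
          Subsingleton (DigitalHomology.cubicalHomology (SimpleGraph.cycleGraph m) q))) ∧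
    (∀ (n : ℕ) (X : Set (Fin n → ℤ)), DigitalHomology.IsEmbeddedCycle X 2 →
      Nonempty (DigitalHomology.c1Homology X 0 ≃+ ℤ) ∧
        ∀ q : ℕ, 0 < q → Subsingleton (DigitalHomology.c1Homology X q)) ∧
    (Nonempty (DigitalHomology.simplicialHomology (SimpleGraph.cycleGraph 4) 0 ≃+ ℤ) ∧
      Nonempty (DigitalHomology.simplicialHomology (SimpleGraph.cycleGraph 4) 1 ≃+ ℤ) ∧
      ∀ q : ℕ, 1 < q →
        Subsingleton (DigitalHomology.simplicialHomology (SimpleGraph.cycleGraph 4) q)) ∧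
    (Nonempty (DigitalHomology.cubicalHomology (SimpleGraph.cycleGraph 4) 0 ≃+ ℤ) ∧
      ∀ q : ℕ, 0 < q →
        Subsingleton (DigitalHomology.cubicalHomology (SimpleGraph.cycleGraph 4) q)) ∧
    (∀ (n : ℕ) (X : Set (Fin n → ℤ)), DigitalHomology.IsEmbeddedCycle X 4 →
      Nonempty (DigitalHomology.c1Homology X 0 ≃+ ℤ) ∧
        ∀ q : ℕ, 0 < q → Subsingleton (DigitalHomology.c1Homology X q)) ∧
    (∀ m : ℕ, 4 < m →
      (Nonempty (DigitalHomology.simplicialHomology (SimpleGraph.cycleGraph m) 0 ≃+ ℤ) ∧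
        Nonempty (DigitalHomology.simplicialHomology (SimpleGraph.cycleGraph m) 1 ≃+ ℤ) ∧
        ∀ q : ℕ, 1 < q →
          Subsingleton (DigitalHomology.simplicialHomology (SimpleGraph.cycleGraph m) q)) ∧
      (Nonempty (DigitalHomology.cubicalHomology (SimpleGraph.cycleGraph m) 0 ≃+ ℤ) ∧
        Nonempty (DigitalHomology.cubicalHomology (SimpleGraph.cycleGraph m) 1 ≃+ ℤ))) ∧
    (∀ m : ℕ, 4 < m → Even m →
      ∀ (n : ℕ) (X : Set (Fin n → ℤ)), DigitalHomology.IsEmbeddedCycle X m → ∀ q : ℕ,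
        Nonempty (DigitalHomology.simplicialHomology (SimpleGraph.cycleGraph m) q ≃+
          DigitalHomology.c1Homology X q)) := by
  open DigitalHomology in
  refine ⟨fun m h1 h4 => ?_, fun n X hX => ?_, ?_, ?_, fun n X hX => ?_, fun m h4 => ?_,
    fun m h4 _ n X hX q => ?_⟩
  · obtain ⟨m, rfl⟩ := Nat.exists_eq_succ_of_ne_zero (Nat.one_le_iff_ne_zero.1 h1)
    refine ⟨⟨simplicialHomology_zero SimpleGraph.cycleGraph_connected, fun q hq => ?_⟩,
      cubicalHomology_zero SimpleGraph.cycleGraph_connected, fun q hq => ?_⟩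
    · obtain ⟨q, rfl⟩ := Nat.exists_eq_succ_of_ne_zero hq.ne'
      exact simplicialHomology_succ_of_cone (cycleGraph_adj_zero h4) q
    · obtain ⟨q, rfl⟩ := Nat.exists_eq_succ_of_ne_zero hq.ne'
      exact cubicalHomology_cycleGraph_succ h1 h4.le q
  · refine ⟨c1Homology_zero X hX.connected, fun q hq => ?_⟩
    match q, hq with
    | 1, _ => exact c1Homology_one_of_two hX
    | q + 2, _ => exact c1Homology_succ_of_isEmpty _ (isEmpty_c1Cube_of_two hX q)
  · refine ⟨simplicialHomology_zero SimpleGraph.cycleGraph_connected,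
      simplicialHomology_cycleGraph_one 0, fun q hq => ?_⟩
    obtain ⟨q, rfl⟩ := Nat.exists_eq_add_of_le' hq
    exact simplicialHomology_cycleGraph_add_two 0 q
  · refine ⟨cubicalHomology_zero SimpleGraph.cycleGraph_connected, fun q hq => ?_⟩
    obtain ⟨q, rfl⟩ := Nat.exists_eq_succ_of_ne_zero hq.ne'
    exact cubicalHomology_cycleGraph_succ (by norm_num) le_rfl q
  · refine ⟨c1Homology_zero X hX.connected, fun q hq => ?_⟩
    match q, hq with
    | 1, _ => exact c1Homology_one_of_four hX
    | 2, _ => exact c1Homology_two_of_four hX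
    | q + 3, _ => exact c1Homology_succ_of_isEmpty _ (isEmpty_c1Cube_add_three hX q)
  · obtain ⟨m, rfl⟩ := Nat.exists_eq_add_of_le' h4
    refine ⟨⟨simplicialHomology_zero SimpleGraph.cycleGraph_connected,
      simplicialHomology_cycleGraph_one (m + 1), fun q hq => ?_⟩,
      cubicalHomology_zero SimpleGraph.cycleGraph_connected, cubicalHomology_cycleGraph_one m⟩
    obtain ⟨q, rfl⟩ := Nat.exists_eq_add_of_le' hq
    exact simplicialHomology_cycleGraph_add_two (m + 1) q
  · obtain ⟨m, rfl⟩ := Nat.exists_eq_add_of_le' h4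
    match q with
    | 0 =>
      obtain ⟨e⟩ := simplicialHomology_zero (SimpleGraph.cycleGraph_connected (n := m + 4))
      obtain ⟨e'⟩ := c1Homology_zero X hX.connected
      exact ⟨e.trans e'.symm⟩
    | 1 =>
      obtain ⟨e⟩ := simplicialHomology_cycleGraph_one (m + 1)
      obtain ⟨e'⟩ := c1Homology_one_of_five_le hX
      exact ⟨e.trans e'.symm⟩
    | q + 2 =>
      have := simplicialHomology_cycleGraph_add_two (m + 1) q
      have := c1Homology_succ_of_isEmpty _ (isEmpty_c1Cube_add_two hX q)
      exact ⟨⟨⟨fun _ => 0, fun _ => 0, fun _ => Subsingleton.elim _ _,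
        fun _ => Subsingleton.elim _ _⟩, fun _ _ => Subsingleton.elim _ _⟩⟩
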